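/- **Theorem 1.8 (finite-time breakdown, undamped cold-ion system).** Consider on $\mathbb R$ the Euler–Poisson system $$\partial_t\rho+\partial_x(\rho u)=0,\qquad \partial_t u+u\,\partial_x u=-\partial_x\phi,\qquad -\partial_{xx}\phi=\rho-e^{\phi},$$ around the constant state $(1,0)$, i.e. $(\rho,u)(t,x)\to(1,0)$ and $\phi(t,x)\to0$ as $|x|\to\infty$, with initial data $(\rho,u)(0,\cdot)=(\rho_0,u_0)$, $\rho_0\ge 0$. A classical solution on $[0,T)$ is a pair $(\rho,u)$, with potential $\phi(t,\cdot)\in C^2(\mathbb R)$, that satisfies all this pointwise and is of class $\mathcal C^1$ on $[0,T)\times\mathbb R$: each $f\in\{\rho,u\}$ is continuously differentiable there, and $|f|+|\partial_tf|+|\partial_xf|$ is bounded on $[0,T']\times\mathbb R$ for every $T'<T$. Let $\phi_0\in C^2(\mathbb R)$ be the initial potential, $-\phi_0''=\rho_0-e^{\phi_0}$ with $\phi_0(x)\to0$ as $|x|\to\infty$, let $U(r)=(r-1)e^r+1$, and assume that the initial energy $$H_0=\int_{\mathbb R}\Big(\tfrac12\rho_0u_0^2+\tfrac12|\phi_0'|^2+U(\phi_0)\Big)\,dx$$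 is finite. Put $V_+(z)=\int_0^z\sqrt{2U(r)}\,dr$ for $z\ge0$ and $V_-(z)=\int_z^0\sqrt{2U(r)}\,dr$ for $z\le0$; these are bijections of $[0,\infty)$, respectively $(-\infty,0]$, onto $[0,\infty)$. Let $c_\pm=\exp\big(V_\pm^{-1}(H_0)\big)$. Suppose that there is a point $x\in\mathbb R$ at which $$-\sqrt{2\rho_0(x)-c_-}<u_0'(x)<\sqrt{2\rho_0(x)-c_++\frac4{c_-}\Big(\frac{c_+}{c_-}-1\Big)\rho_0(x)^2}$$ fails (where $2\rho_0(x)<c_-$ both radicands are negative, and the condition counts as failing). Then the classical solution loses $\mathcal C^1$ regularity in finite time: there is a finite $T_*>0$, depending only on $(\rho_0,u_0)$, such that every classical solution on $[0,T)$ with initial data $(\rho_0,u_0)$ has $T\le T_*$. -/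

import Mathlib

open Set Filter Topology MeasureTheory

noncomputable section

namespace ColdIon

/-- `f ∈ C¹([0,T) × ℝ)`: `f` is continuously differentiable on `[0,T) × ℝ` (one-sided in time at
`t = 0`), and `|f| + |∂ₜ f| + |∂ₓ f|` is bounded on `[0,T'] × ℝ` for every `T' < T`. -/
def IsClassC1 (T : ℝ) (f : ℝ → ℝ → ℝ) : Prop :=
  ContDiffOn ℝ 1 (fun p : ℝ × ℝ => f p.1 p.2) (Ico 0 T ×ˢ univ) ∧
  ∀ T' < T, ∃ M : ℝ, ∀ t ∈ Icc 0 T', ∀ x : ℝ,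
    |f t x| + |derivWithin (fun s => f s x) (Ici 0) t| + |deriv (f t) x| ≤ M

/-- `φ` is the electric potential generated by the density `ρ` (at a fixed time):
a `C²` solution of `-φ'' = ρ - e^φ` on `ℝ` with `φ(x) → 0` as `|x| → ∞`. -/
structure IsPotential (ρ φ : ℝ → ℝ) : Prop where
  contDiff : ContDiff ℝ 2 φ
  poisson : ∀ x, -deriv (deriv φ) x = ρ x - Real.exp (φ x)
  decay : Tendsto φ (cocompact ℝ) (𝓝 0)

/-- `(ρ, u)`, with potential `φ`, is a classical solution on `[0,T) × ℝ` of the undamped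
Euler--Poisson system for cold ions around the constant state `(1,0)`, with initial data
`(ρ₀, u₀)`. -/
structure IsClassicalSolution (T : ℝ) (ρ₀ u₀ : ℝ → ℝ) (ρ u φ : ℝ → ℝ → ℝ) : Prop where
  pos : 0 < T
  density_C1 : IsClassC1 T ρ
  velocity_C1 : IsClassC1 T u
  continuity : ∀ t ∈ Ioo 0 T, ∀ x,
    deriv (fun s => ρ s x) t + deriv (fun y => ρ t y * u t y) x = 0
  momentum : ∀ t ∈ Ioo 0 T, ∀ x,
    deriv (fun s => u s x) t + u t x * deriv (u t) x = -deriv (φ t) x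
  potential : ∀ t ∈ Ico 0 T, IsPotential (ρ t) (φ t)
  density_infty : ∀ t ∈ Ico 0 T, Tendsto (ρ t) (cocompact ℝ) (𝓝 1)
  velocity_infty : ∀ t ∈ Ico 0 T, Tendsto (u t) (cocompact ℝ) (𝓝 0)
  density_init : ∀ x, ρ 0 x = ρ₀ x
  velocity_init : ∀ x, u 0 x = u₀ x

/-- `U(r) = (r - 1) e^r + 1`. -/
def U (r : ℝ) : ℝ := (r - 1) * Real.exp r + 1

/-- The energy density `½ ρ u² + ½ |∂ₓφ|² + U(φ)` at a fixed time. -/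
def energyDensity (ρ u φ : ℝ → ℝ) (x : ℝ) : ℝ :=
  1 / 2 * ρ x * u x ^ 2 + 1 / 2 * deriv φ x ^ 2 + U (φ x)

/-- The total energy at a fixed time. -/
def energy (ρ u φ : ℝ → ℝ) : ℝ := ∫ x, energyDensity ρ u φ x

/-- `V₊(z) = ∫₀ᶻ √(2U(r)) dr`, used for `z ≥ 0`. -/
def Vplus (z : ℝ) : ℝ := ∫ r in (0 : ℝ)..z, Real.sqrt (2 * U r)

/-- `V₋(z) = ∫_z⁰ √(2U(r)) dr`, used for `z ≤ 0`. -/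
def Vminus (z : ℝ) : ℝ := ∫ r in z..(0 : ℝ), Real.sqrt (2 * U r)

/-- `c₊ = exp (V₊⁻¹(H))`, with `V₊⁻¹` the inverse of the bijection `V₊ : [0,∞) → [0,∞)`. -/
def cplus (H : ℝ) : ℝ := Real.exp (Function.invFunOn Vplus (Ici 0) H)

/-- `c₋ = exp (V₋⁻¹(H))`, with `V₋⁻¹` the inverse of the bijection `V₋ : (-∞,0] → [0,∞)`. -/
def cminus (H : ℝ) : ℝ := Real.exp (Function.invFunOn Vminus (Iic 0) H)

/-- The pointwise threshold condition
`-√(2ρ₀ - c₋) < u₀' < √(2ρ₀ - c₊ + (4/c₋)(c₊/c₋ - 1) ρ₀²)` for given values `r = ρ₀(x)` and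
`v = u₀'(x)`. When `0 ≤ r < c₋/2` both radicands are negative (if `0 < c₋ ≤ c₊`), both roots are
`0` by convention, and the condition fails, as it should. -/
def Threshold (cm cp r v : ℝ) : Prop :=
  -Real.sqrt (2 * r - cm) < v ∧
    v < Real.sqrt (2 * r - cp + 4 / cm * (cp / cm - 1) * r ^ 2)

end ColdIon

end

/-!
Let `X` be a characteristic, `X' = u(t, X)`, and let `y = exp ∫ ∂ₓu(s, X(s)) ds` be the factor by
which the flow stretches lengths along it. Mass conservation reads `ρ(t, X) y = ρ₀`, and
differentiating the momentum equation with respect to the initial point of the characteristic turns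
it into `y'' + e^φ y = ρ₀` with `y(0) = 1`, `y'(0) = u₀'`. The energy does not increase and, since
`|∂ₓ V(φ)| = |∂ₓφ| √(2U(φ)) ≤ ½ |∂ₓφ|² + U(φ)`, it controls `V(φ)`; hence `c₋ ≤ e^φ ≤ c₊`.

So `y` can be compared with the oscillator `q'' + c₋ q = ρ₀`. If `y' ≤ 0` at a time when the energy
of that oscillator is at least its value at `q = q' = 0`, then `y` would vanish within half a
period. This is the case at `t = 0` if the lower inequality of the threshold fails. If the upper
one fails, `y' ≥ 0` at first; then `y'² + c₊ y² - 2 ρ₀ y` cannot decrease, `y` turns around in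
bounded time, and it does so at a height `y ≥ 2 ρ₀ / c₋`, where the first case applies. But `y` is
an exponential and never vanishes, so the solution cannot last that long.
-/

noncomputable section

namespace ColdIon

/-! ### Families of functions that are Lipschitz in time -/

/-- `f t x` is Lipschitz in `t ∈ S` with constant `C`, uniformly in `x`. -/
def TimeLipschitz {α : Type*} (C : ℝ) (S : Set ℝ) (f : ℝ → α → ℝ) : Prop :=
  ∀ s ∈ S, ∀ t ∈ S, ∀ x, |f t x - f s x| ≤ C * |t - s|

theorem eventually_mul_abs_sub_lt (C s : ℝ) {ε : ℝ} (hε : 0 < ε) :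
    ∀ᶠ t in 𝓝 s, C * |t - s| < ε :=
  (Continuous.tendsto' (by fun_prop) s 0 (by simp)).eventually_lt_const hε

namespace TimeLipschitz

variable {α : Type*} {C : ℝ} {S : Set ℝ} {f : ℝ → α → ℝ}

theorem mono {C' : ℝ} (hf : TimeLipschitz C S f) (hC : C ≤ C') : TimeLipschitz C' S f :=
  fun s hs t ht x => (hf s hs t ht x).trans (mul_le_mul_of_nonneg_right hC (abs_nonneg _))

theorem lipschitzOnWith (hf : TimeLipschitz C S f) (x : α) :
    LipschitzOnWith C.toNNReal (fun t => f t x) S :=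
  LipschitzOnWith.of_dist_le' fun t ht s hs => hf s hs t ht x

theorem mul {g : ℝ → α → ℝ} {A B D : ℝ} (hf : TimeLipschitz C S f) (hg : TimeLipschitz D S g)
    (hA : ∀ t ∈ S, ∀ x, |f t x| ≤ A) (hB : ∀ t ∈ S, ∀ x, |g t x| ≤ B) :
    TimeLipschitz (A * D + B * C) S (fun t x => f t x * g t x) := by
  intro s hs t ht x
  calc |f t x * g t x - f s x * g s x|
      = |f t x * (g t x - g s x) + g s x * (f t x - f s x)| := by ring_nf
    _ ≤ |f t x| * |g t x - g s x| + |g s x| * |f t x - f s x| := by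
      rw [← abs_mul, ← abs_mul]; exact abs_add_le _ _
    _ ≤ A * (D * |t - s|) + B * (C * |t - s|) := by
      have hA₀ : 0 ≤ A := (abs_nonneg _).trans (hA t ht x)
      have hB₀ : 0 ≤ B := (abs_nonneg _).trans (hB t ht x)
      gcongr
      exacts [hA t ht x, hg s hs t ht x, hB s hs x, hf s hs t ht x]
    _ = (A * D + B * C) * |t - s| := by ring

theorem continuousOn_prod [TopologicalSpace α] (hf : TimeLipschitz C S f)
    (hcont : ∀ t ∈ S, Continuous (f t)) :
    ContinuousOn (fun p : ℝ × α => f p.1 p.2) (S ×ˢ univ) :=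
  continuousOn_prod_of_continuousOn_lipschitzOnWith _ C.toNNReal
    (fun t ht => (hcont t ht).continuousOn) fun x _ => hf.lipschitzOnWith x

theorem continuousOn_along [TopologicalSpace α] (hf : TimeLipschitz C S f)
    (hcont : ∀ t ∈ S, Continuous (f t)) {X : ℝ → α} (hX : ContinuousOn X S) :
    ContinuousOn (fun t => f t (X t)) S :=
  (hf.continuousOn_prod hcont).comp (f := fun t : ℝ => (t, X t)) (continuousOn_id.prodMk hX)
    fun _ ht => ⟨ht, mem_univ _⟩

theorem eventually_abs_le (hf : TimeLipschitz C S f) (hS : IsCompact S) {l : Filter α}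
    (hl : ∀ t ∈ S, Tendsto (f t) l (𝓝 0)) {ε : ℝ} (hε : 0 < ε) :
    ∀ᶠ x in l, ∀ t ∈ S, |f t x| ≤ ε := by
  refine hS.induction_on (p := fun S' => ∀ᶠ x in l, ∀ t ∈ S', |f t x| ≤ ε) (by simp)
    (fun _ _ hsub h => h.mono fun x hx t ht => hx t (hsub ht)) ?_ ?_
  · intro _ _ h h'
    filter_upwards [h, h'] with x hx hx' t ht
    exact ht.elim (hx t) (hx' t)
  · intro s hs
    refine ⟨S ∩ {t | C * |t - s| < ε / 2}, inter_mem self_mem_nhdsWithin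
      (mem_nhdsWithin_of_mem_nhds (eventually_mul_abs_sub_lt C s (half_pos hε))), ?_⟩
    filter_upwards [(hl s hs).abs.eventually_lt_const (u := ε / 2) (by simpa using hε)]
      with x hx t ⟨ht, hts⟩
    linarith [abs_sub_abs_le_abs_sub (f t x) (f s x), hf s hs t ht x, mem_ofPred.1 hts]

theorem hasDerivAt_integral {f : ℝ → ℝ → ℝ} {f' : ℝ → ℝ} {a b s : ℝ} (hf : TimeLipschitz C S f)
    (hS : S ∈ 𝓝 s) (hcont : ∀ t ∈ S, Continuous (f t))
    (hd : ∀ x, HasDerivAt (fun t => f t x) (f' x) s) (hf' : Continuous f') :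
    HasDerivAt (fun t => ∫ x in a..b, f t x) (∫ x in a..b, f' x) s := by
  refine (intervalIntegral.hasDerivAt_integral_of_dominated_loc_of_lip
    (bound := fun _ => (C.toNNReal : ℝ)) hS
    (mem_of_superset hS fun t ht => (hcont t ht).aestronglyMeasurable)
    ((hcont s (mem_of_mem_nhds hS)).intervalIntegrable _ _) hf'.aestronglyMeasurable
    (Eventually.of_forall fun x _ => ?_) intervalIntegrable_const
    (Eventually.of_forall fun x _ => hd x)).2
  rw [Real.nnabs_of_nonneg (NNReal.coe_nonneg _), Real.toNNReal_coe]
  exact hf.lipschitzOnWith x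

end TimeLipschitz

/-! ### Functions of class `C¹` on `[0,T) × ℝ` -/

theorem Icc_subset_Ico_of_lt {τ T : ℝ} (hτ : τ < T) : Icc 0 τ ⊆ Ico 0 T :=
  fun _ ht => ⟨ht.1, ht.2.trans_lt hτ⟩

namespace IsClassC1

variable {T : ℝ} {f : ℝ → ℝ → ℝ}

theorem differentiableAt (hf : IsClassC1 T f) {t : ℝ} (ht : t ∈ Ioo 0 T) (x : ℝ) :
    DifferentiableAt ℝ (fun p : ℝ × ℝ => f p.1 p.2) (t, x) :=
  (hf.1.differentiableOn one_ne_zero (t, x) ⟨Ioo_subset_Ico_self ht, mem_univ _⟩).differentiableAt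
    (prod_mem_nhds (Ico_mem_nhds ht.1 ht.2) univ_mem)

theorem hasDerivAt_fderivWithin (hf : IsClassC1 T f) {t : ℝ} (ht : t ∈ Ico 0 T) (x : ℝ) :
    HasDerivAt (f t)
      (fderivWithin ℝ (fun p : ℝ × ℝ => f p.1 p.2) (Ico 0 T ×ˢ univ) (t, x) (0, 1)) x := by
  have hline : HasDerivWithinAt (fun y : ℝ => (t, y)) ((0 : ℝ), (1 : ℝ)) univ x :=
    ((hasDerivAt_const x t).prodMk (hasDerivAt_id x)).hasDerivWithinAt
  exact hasDerivWithinAt_univ.1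
    ((hf.1.differentiableOn one_ne_zero (t, x) ⟨ht, mem_univ _⟩).hasFDerivWithinAt
      |>.comp_hasDerivWithinAt x hline fun _ _ => ⟨ht, mem_univ _⟩)

theorem hasDerivAt_space (hf : IsClassC1 T f) {t : ℝ} (ht : t ∈ Ico 0 T) (x : ℝ) :
    HasDerivAt (f t) (deriv (f t) x) x :=
  (hf.hasDerivAt_fderivWithin ht x).differentiableAt.hasDerivAt

theorem hasDerivAt_along (hf : IsClassC1 T f) {t : ℝ} (ht : t ∈ Ioo 0 T) {X : ℝ → ℝ} {v : ℝ}
    (hX : HasDerivAt X v t) :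
    HasDerivAt (fun s => f s (X s))
      (deriv (fun s => f s (X t)) t + v * deriv (f t) (X t)) t := by
  have hd := (hf.differentiableAt ht (X t)).hasFDerivAt
  set L := fderiv ℝ (fun p : ℝ × ℝ => f p.1 p.2) (t, X t)
  have htime : deriv (fun s => f s (X t)) t = L (1, 0) :=
    (hd.comp_hasDerivAt (f := fun s => (s, X t)) t
      ((hasDerivAt_id t).prodMk (hasDerivAt_const t (X t)))).deriv
  have hspace : deriv (f t) (X t) = L (0, 1) :=
    (hd.comp_hasDerivAt (f := fun y => (t, y)) (X t)
      ((hasDerivAt_const (X t) t).prodMk (hasDerivAt_id (X t)))).deriv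
  have hL : L (1, v) = L (1, 0) + v * L (0, 1) := by
    rw [show ((1 : ℝ), v) = (1, 0) + v • ((0 : ℝ), (1 : ℝ)) by simp, map_add, map_smul,
      smul_eq_mul]
  rw [htime, hspace, ← hL]
  exact hd.comp_hasDerivAt t ((hasDerivAt_id t).prodMk hX)

theorem hasDerivAt_time (hf : IsClassC1 T f) {t : ℝ} (ht : t ∈ Ioo 0 T) (x : ℝ) :
    HasDerivAt (fun s => f s x) (deriv (fun s => f s x) t) t :=
  (hf.hasDerivAt_along ht (hasDerivAt_const t x)).differentiableAt.hasDerivAt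

theorem continuousOn_deriv_space (hf : IsClassC1 T f) :
    ContinuousOn (fun p : ℝ × ℝ => deriv (f p.1) p.2) (Ico 0 T ×ˢ univ) := by
  have h := hf.1.continuousOn_fderivWithin
    ((uniqueDiffOn_Ico 0 T).prod uniqueDiffOn_univ) le_rfl
  exact (h.clm_apply (continuousOn_const (c := ((0 : ℝ), (1 : ℝ))))).congr fun p hp =>
    (hf.hasDerivAt_fderivWithin hp.1 p.2).deriv

theorem continuousOn_along (hf : IsClassC1 T f) {s : Set ℝ} (hs : s ⊆ Ico 0 T) {X : ℝ → ℝ}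
    (hX : ContinuousOn X s) : ContinuousOn (fun t => f t (X t)) s :=
  hf.1.continuousOn.comp (continuousOn_id.prodMk hX) fun _ ht => ⟨hs ht, mem_univ _⟩

theorem continuousOn_deriv_along (hf : IsClassC1 T f) {s : Set ℝ} (hs : s ⊆ Ico 0 T) {X : ℝ → ℝ}
    (hX : ContinuousOn X s) : ContinuousOn (fun t => deriv (f t) (X t)) s :=
  hf.continuousOn_deriv_space.comp (f := fun t : ℝ => (t, X t)) (continuousOn_id.prodMk hX)
    fun _ ht => ⟨hs ht, mem_univ _⟩

theorem contDiff_space (hf : IsClassC1 T f) {t : ℝ} (ht : t ∈ Ico 0 T) : ContDiff ℝ 1 (f t) :=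
  hf.1.comp_contDiff (contDiff_const.prodMk contDiff_id) fun _ => ⟨ht, mem_univ _⟩

theorem lipschitz_space (hf : IsClassC1 T f) {t : ℝ} (ht : t ∈ Ico 0 T) {M : ℝ}
    (hM : ∀ x, |deriv (f t) x| ≤ M) (x y : ℝ) : |f t x - f t y| ≤ M * |x - y| :=
  convex_univ.norm_image_sub_le_of_norm_deriv_le
    (fun z _ => (hf.hasDerivAt_space ht z).differentiableAt) (fun z _ => hM z)
    (mem_univ _) (mem_univ _)

theorem timeLipschitz (hf : IsClassC1 T f) {τ M : ℝ} (hτ : τ < T)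
    (hM : ∀ t ∈ Ioc 0 τ, ∀ x, |deriv (fun s => f s x) t| ≤ M) : TimeLipschitz M (Icc 0 τ) f := by
  intro s hs t ht x
  wlog hst : s < t generalizing s t
  · rcases (not_lt.1 hst).eq_or_lt with rfl | hts
    · simp
    · rw [abs_sub_comm, abs_sub_comm t s]
      exact this t ht s hs hts
  have hcont : ContinuousOn (fun s => f s x) (Icc s t) :=
    hf.continuousOn_along (fun r hr => ⟨hs.1.trans hr.1, (hr.2.trans ht.2).trans_lt hτ⟩)
      continuousOn_const
  obtain ⟨c, hc, hslope⟩ := exists_deriv_eq_slope (fun s => f s x) hst hcont fun r hr =>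
    (hf.hasDerivAt_time ⟨hs.1.trans_lt hr.1, (hr.2.trans_le ht.2).trans hτ⟩
      x).differentiableAt.differentiableWithinAt
  have hbound := hM c ⟨hs.1.trans_lt hc.1, hc.2.le.trans ht.2⟩ x
  rwa [hslope, abs_div, div_le_iff₀ (abs_pos.2 (sub_ne_zero.2 hst.ne'))] at hbound

theorem exists_bound (hf : IsClassC1 T f) {τ : ℝ} (hτ : τ < T) :
    ∃ M : ℝ, 0 ≤ M ∧ (∀ t ∈ Icc 0 τ, ∀ x, |f t x| ≤ M) ∧
      (∀ t ∈ Icc 0 τ, ∀ x, |deriv (f t) x| ≤ M) ∧ TimeLipschitz M (Icc 0 τ) f := by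
  obtain ⟨M, hM⟩ := hf.2 τ hτ
  have hbound : ∀ t ∈ Icc 0 τ, ∀ x, |f t x| ≤ |M| ∧
      |derivWithin (fun s => f s x) (Ici 0) t| ≤ |M| ∧ |deriv (f t) x| ≤ |M| := fun t ht x => by
    have hsum := (hM t ht x).trans (le_abs_self M)
    have hval := abs_nonneg (f t x)
    have htime := abs_nonneg (derivWithin (fun s => f s x) (Ici 0) t)
    have hspace := abs_nonneg (deriv (f t) x)
    exact ⟨by linarith, by linarith, by linarith⟩
  refine ⟨|M|, abs_nonneg _, fun t ht x => (hbound t ht x).1,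
    fun t ht x => (hbound t ht x).2.2, hf.timeLipschitz hτ fun t ht x => ?_⟩
  rw [← derivWithin_of_mem_nhds (Ici_mem_nhds ht.1)]
  exact (hbound t (Ioc_subset_Icc_self ht) x).2.1

end IsClassC1

/-! ### The Poisson equation -/

theorem deriv_deriv_nonpos_of_isLocalMax {f : ℝ → ℝ} {x : ℝ} (hmax : IsLocalMax f x)
    (hf : ContinuousAt f x) : deriv (deriv f) x ≤ 0 := by
  by_contra! hpos
  have hmin : IsLocalMin f x := isLocalMin_of_deriv_deriv_pos hpos hmax.deriv_eq_zero hf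
  have hconst : f =ᶠ[𝓝 x] fun _ => f x := by
    filter_upwards [hmax, hmin] with y hle hge using le_antisymm hle hge
  have hzero : deriv (deriv f) x = 0 := by
    rw [hconst.deriv.deriv_eq]
    simp
  exact hpos.ne' hzero

theorem abs_deriv_le_of_second_deriv {f f' f'' : ℝ → ℝ} {A B : ℝ}
    (hf : ∀ y, HasDerivAt f (f' y) y) (hf' : ∀ y, HasDerivAt f' (f'' y) y)
    (hA : ∀ y, |f y| ≤ A) (hB : ∀ y, |f'' y| ≤ B) (x : ℝ) : |f' x| ≤ 2 * A + B := by
  obtain ⟨c, hc, hslope⟩ := exists_hasDerivAt_eq_slope f f' (lt_add_one x)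
    (fun z _ => (hf z).continuousAt.continuousWithinAt) (fun z _ => hf z)
  have hc_bound : |f' c| ≤ 2 * A := by
    rw [hslope, add_sub_cancel_left, div_one]
    linarith [abs_sub (f (x + 1)) (f x), hA (x + 1), hA x]
  have hdiff : |f' x - f' c| ≤ B * |x - c| :=
    convex_univ.norm_image_sub_le_of_norm_hasDerivWithin_le
      (fun z _ => (hf' z).hasDerivWithinAt) (fun z _ => hB z) (mem_univ _) (mem_univ _)
  have hdist : |x - c| ≤ 1 := abs_le.2 ⟨by linarith [hc.2], by linarith [hc.1]⟩
  have hB₀ : 0 ≤ B := (abs_nonneg _).trans (hB x)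
  linarith [abs_sub_abs_le_abs_sub (f' x) (f' c), mul_le_of_le_one_right hB₀ hdist]

theorem abs_exp_sub_exp_le {a b m : ℝ} (ha : a ≤ m) (hb : b ≤ m) :
    |Real.exp a - Real.exp b| ≤ Real.exp m * |a - b| :=
  (convex_Iic m).norm_image_sub_le_of_norm_hasDerivWithin_le
    (fun z _ => (Real.hasDerivAt_exp z).hasDerivWithinAt)
    (fun z hz => by
      rw [Real.norm_eq_abs, Real.abs_exp]
      exact Real.exp_le_exp.2 hz) hb ha

theorem exp_mul_sub_le (a b : ℝ) : Real.exp b * (a - b) ≤ Real.exp a - Real.exp b := by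
  have htangent := mul_le_mul_of_nonneg_left (Real.add_one_le_exp (a - b)) (Real.exp_pos b).le
  rw [← Real.exp_add, add_sub_cancel] at htangent
  linarith

namespace IsPotential

variable {ρ φ ρ₁ ρ₂ φ₁ φ₂ : ℝ → ℝ}

theorem hasDerivAt (h : IsPotential ρ φ) (x : ℝ) : HasDerivAt φ (deriv φ x) x :=
  (h.contDiff.differentiable two_ne_zero x).hasDerivAt

theorem contDiff_deriv (h : IsPotential ρ φ) : ContDiff ℝ 1 (deriv φ) :=
  (contDiff_succ_iff_deriv.1 (show ContDiff ℝ (1 + 1) φ from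
    one_add_one_eq_two (R := WithTop ℕ∞) ▸ h.contDiff)).2.2

theorem deriv_deriv (h : IsPotential ρ φ) (x : ℝ) :
    deriv (deriv φ) x = Real.exp (φ x) - ρ x := by
  linarith [h.poisson x]

theorem hasDerivAt_deriv (h : IsPotential ρ φ) (x : ℝ) :
    HasDerivAt (deriv φ) (Real.exp (φ x) - ρ x) x :=
  h.deriv_deriv x ▸ (h.contDiff_deriv.differentiable one_ne_zero x).hasDerivAt

theorem continuous (h : IsPotential ρ φ) : Continuous φ := h.contDiff.continuous

theorem continuous_deriv (h : IsPotential ρ φ) : Continuous (deriv φ) :=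
  h.contDiff_deriv.continuous

theorem zero : IsPotential (fun _ => 1) fun _ => 0 where
  contDiff := contDiff_const
  poisson x := by simp
  decay := tendsto_const_nhds

theorem exists_max_sub (h₁ : IsPotential ρ₁ φ₁) (h₂ : IsPotential ρ₂ φ₂) {x : ℝ}
    (hx : 0 < φ₁ x - φ₂ x) :
    ∃ x₀, φ₁ x - φ₂ x ≤ φ₁ x₀ - φ₂ x₀ ∧
      Real.exp (φ₁ x₀) - Real.exp (φ₂ x₀) ≤ ρ₁ x₀ - ρ₂ x₀ := by
  have hlim : Tendsto (fun y => φ₁ y - φ₂ y) (cocompact ℝ) (𝓝 0) := by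
    simpa using h₁.decay.sub h₂.decay
  obtain ⟨x₀, hx₀⟩ := (h₁.continuous.sub h₂.continuous).exists_forall_ge' x
    ((hlim.eventually_lt_const hx).mono fun _ hy => hy.le)
  have hsecond : deriv (deriv fun y => φ₁ y - φ₂ y) x₀
      = (Real.exp (φ₁ x₀) - ρ₁ x₀) - (Real.exp (φ₂ x₀) - ρ₂ x₀) := by
    rw [show deriv (fun y => φ₁ y - φ₂ y) = fun y => deriv φ₁ y - deriv φ₂ y from
      funext fun y => ((h₁.hasDerivAt y).sub (h₂.hasDerivAt y)).deriv]
    exact ((h₁.hasDerivAt_deriv x₀).sub (h₂.hasDerivAt_deriv x₀)).deriv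
  have hnonpos : deriv (deriv fun y => φ₁ y - φ₂ y) x₀ ≤ 0 :=
    deriv_deriv_nonpos_of_isLocalMax (Eventually.of_forall hx₀)
      (h₁.continuous.sub h₂.continuous).continuousAt
  exact ⟨x₀, hx₀ x, by linarith⟩

theorem unique (h₁ : IsPotential ρ φ₁) (h₂ : IsPotential ρ φ₂) : φ₁ = φ₂ := by
  have hle : ∀ {φ ψ : ℝ → ℝ}, IsPotential ρ φ → IsPotential ρ ψ → φ ≤ ψ := by
    intro φ ψ hφ hψ x
    by_contra! hx
    obtain ⟨x₀, hge, hexp⟩ := hφ.exists_max_sub hψ (sub_pos.2 hx)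
    rw [sub_self, sub_nonpos, Real.exp_le_exp] at hexp
    linarith
  exact le_antisymm (hle h₁ h₂) (hle h₂ h₁)

theorem sub_le (h₁ : IsPotential ρ₁ φ₁) (h₂ : IsPotential ρ₂ φ₂) {ε m : ℝ} (hε₀ : 0 ≤ ε)
    (hε : ∀ x, ρ₁ x - ρ₂ x ≤ ε) (hm : ∀ x, -m ≤ φ₂ x) (x : ℝ) :
    φ₁ x - φ₂ x ≤ Real.exp m * ε := by
  rcases le_or_gt (φ₁ x - φ₂ x) 0 with hx | hx
  · exact hx.trans (by positivity)
  obtain ⟨x₀, hmax, hexp⟩ := h₁.exists_max_sub h₂ hx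
  have hconvex : Real.exp (-m) * (φ₁ x₀ - φ₂ x₀) ≤ ε :=
    calc Real.exp (-m) * (φ₁ x₀ - φ₂ x₀)
        ≤ Real.exp (φ₂ x₀) * (φ₁ x₀ - φ₂ x₀) :=
          mul_le_mul_of_nonneg_right (Real.exp_le_exp.2 (hm x₀)) (hx.le.trans hmax)
      _ ≤ Real.exp (φ₁ x₀) - Real.exp (φ₂ x₀) := exp_mul_sub_le _ _
      _ ≤ ε := hexp.trans (hε x₀)
  rw [Real.exp_neg, inv_mul_le_iff₀ (Real.exp_pos m)] at hconvex
  exact hmax.trans hconvex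

theorem le_of_density_le (h : IsPotential ρ φ) {M : ℝ} (hM₀ : 0 ≤ M) (hM : ∀ x, ρ x - 1 ≤ M)
    (x : ℝ) : φ x ≤ M := by
  simpa using h.sub_le zero (m := 0) hM₀ hM (by simp) x

theorem exists_lower_bound (h : IsPotential ρ φ) : ∃ m, ∀ x, -m ≤ φ x := by
  by_cases! hx : ∃ x, φ x < 0
  · obtain ⟨x, hx⟩ := hx
    obtain ⟨x₀, hx₀⟩ := h.continuous.exists_forall_le' x
      ((h.decay.eventually_const_lt hx).mono fun _ hy => hy.le)
    exact ⟨-φ x₀, by simpa using hx₀⟩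
  · exact ⟨0, by simpa using hx⟩

theorem lower_bound_of_close (h₁ : IsPotential ρ₁ φ₁) (h₂ : IsPotential ρ₂ φ₂) {m : ℝ}
    (hm : ∀ x, -m ≤ φ₁ x) (hclose : ∀ x, ρ₁ x - ρ₂ x ≤ Real.exp (-m) / 2) (x : ℝ) :
    -(m + 1) ≤ φ₂ x := by
  by_contra! hx
  obtain ⟨x₀, hmax, hexp⟩ := h₁.exists_max_sub h₂ (x := x) (by linarith [hm x])
  have hexp_ge : Real.exp (-m) ≤ Real.exp (φ₁ x₀) := Real.exp_le_exp.2 (hm x₀)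
  have hexp_one : Real.exp (φ₂ x₀) * Real.exp 1 ≤ Real.exp (φ₁ x₀) := by
    rw [← Real.exp_add]
    exact Real.exp_le_exp.2 (by linarith [hm x])
  nlinarith [hclose x₀, Real.exp_one_gt_d9, Real.exp_pos (φ₂ x₀)]

end IsPotential

section

variable {τ M m : ℝ} {ρ φ : ℝ → ℝ → ℝ}

theorem exists_uniform_lower_bound (hφ : ∀ t ∈ Icc 0 τ, IsPotential (ρ t) (φ t))
    (hlip : TimeLipschitz M (Icc 0 τ) ρ) : ∃ m, ∀ t ∈ Icc 0 τ, ∀ x, -m ≤ φ t x := by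
  refine isCompact_Icc.induction_on (p := fun S => ∃ m, ∀ t ∈ S, ∀ x, -m ≤ φ t x) ⟨0, by simp⟩
    (fun _ _ hsub ⟨m, hm⟩ => ⟨m, fun t ht => hm t (hsub ht)⟩) ?_ ?_
  · rintro _ _ ⟨m, hm⟩ ⟨m', hm'⟩
    refine ⟨max m m', fun t ht x => ?_⟩
    rcases ht with ht | ht
    · exact (neg_le_neg (le_max_left _ _)).trans (hm t ht x)
    · exact (neg_le_neg (le_max_right _ _)).trans (hm' t ht x)
  · intro s hs
    obtain ⟨m, hm⟩ := (hφ s hs).exists_lower_bound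
    refine ⟨Icc 0 τ ∩ {t | M * |t - s| < Real.exp (-m) / 2}, inter_mem self_mem_nhdsWithin
      (mem_nhdsWithin_of_mem_nhds (eventually_mul_abs_sub_lt M s (by positivity))), m + 1, ?_⟩
    rintro t ⟨ht, hts⟩ x
    refine (hφ s hs).lower_bound_of_close (hφ t ht) hm (fun y => ?_) x
    linarith [(abs_le.1 (hlip s hs t ht y)).1, mem_ofPred.1 hts]

theorem timeLipschitz_potential (hφ : ∀ t ∈ Icc 0 τ, IsPotential (ρ t) (φ t)) (hM : 0 ≤ M)
    (hlip : TimeLipschitz M (Icc 0 τ) ρ) (hm : ∀ t ∈ Icc 0 τ, ∀ x, |φ t x| ≤ m) :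
    TimeLipschitz (Real.exp m * M) (Icc 0 τ) φ := by
  intro s hs t ht x
  have hρ : ∀ y, |ρ t y - ρ s y| ≤ M * |t - s| := hlip s hs t ht
  rw [mul_assoc, abs_sub_le_iff]
  exact ⟨(hφ t ht).sub_le (hφ s hs) (by positivity) (fun y => (abs_sub_le_iff.1 (hρ y)).1)
      (fun y => (abs_le.1 (hm s hs y)).1) x,
    (hφ s hs).sub_le (hφ t ht) (by positivity) (fun y => (abs_sub_le_iff.1 (hρ y)).2)
      (fun y => (abs_le.1 (hm t ht y)).1) x⟩

theorem timeLipschitz_field {A : ℝ} (hφ : ∀ t ∈ Icc 0 τ, IsPotential (ρ t) (φ t))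
    (hρ : TimeLipschitz M (Icc 0 τ) ρ) (hm : ∀ t ∈ Icc 0 τ, ∀ x, |φ t x| ≤ m)
    (hA : TimeLipschitz A (Icc 0 τ) φ) :
    TimeLipschitz (2 * A + (Real.exp m * A + M)) (Icc 0 τ) fun t => deriv (φ t) := by
  intro s hs t ht x
  refine (abs_deriv_le_of_second_deriv
    (fun y => ((hφ t ht).hasDerivAt y).sub ((hφ s hs).hasDerivAt y))
    (fun y => ((hφ t ht).hasDerivAt_deriv y).sub ((hφ s hs).hasDerivAt_deriv y))
    (hA s hs t ht) (B := (Real.exp m * A + M) * |t - s|) (fun y => ?_) x).trans_eq (by ring)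
  calc |Real.exp (φ t y) - ρ t y - (Real.exp (φ s y) - ρ s y)|
      = |(Real.exp (φ t y) - Real.exp (φ s y)) - (ρ t y - ρ s y)| := by ring_nf
    _ ≤ |Real.exp (φ t y) - Real.exp (φ s y)| + |ρ t y - ρ s y| := abs_sub _ _
    _ ≤ Real.exp m * (A * |t - s|) + M * |t - s| := by
      refine add_le_add ((abs_exp_sub_exp_le ((le_abs_self _).trans (hm t ht y))
        ((le_abs_self _).trans (hm s hs y))).trans ?_) (hρ s hs t ht y)
      exact mul_le_mul_of_nonneg_left (hA s hs t ht y) (Real.exp_pos m).le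
    _ = (Real.exp m * A + M) * |t - s| := by ring

theorem exists_potential_bounds (hφ : ∀ t ∈ Icc 0 τ, IsPotential (ρ t) (φ t)) (hM : 0 ≤ M)
    (hρ : ∀ t ∈ Icc 0 τ, ∀ x, |ρ t x| ≤ M) (hlip : TimeLipschitz M (Icc 0 τ) ρ) :
    ∃ C, 0 ≤ C ∧ (∀ t ∈ Icc 0 τ, ∀ x, |φ t x| ≤ C) ∧ TimeLipschitz C (Icc 0 τ) φ ∧
      TimeLipschitz C (Icc 0 τ) fun t => deriv (φ t) := by
  obtain ⟨m₀, hm₀⟩ := exists_uniform_lower_bound hφ hlip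
  set m := max m₀ M
  have hm_nonneg : 0 ≤ m := hM.trans (le_max_right _ _)
  have hm : ∀ t ∈ Icc 0 τ, ∀ x, |φ t x| ≤ m := fun t ht x => abs_le.2
    ⟨(neg_le_neg (le_max_left _ _)).trans (hm₀ t ht x),
      ((hφ t ht).le_of_density_le hM (fun y => by linarith [(abs_le.1 (hρ t ht y)).2]) x).trans
        (le_max_right _ _)⟩
  set E := Real.exp m
  have hA : 0 ≤ E * M := by positivity
  have hEA : 0 ≤ E * (E * M) := by positivity
  have hφ_lip : TimeLipschitz (E * M) (Icc 0 τ) φ := timeLipschitz_potential hφ hM hlip hm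
  exact ⟨m + (2 * (E * M) + (E * (E * M) + M)), by positivity,
    fun t ht x => (hm t ht x).trans (by linarith), hφ_lip.mono (by linarith),
    (timeLipschitz_field hφ hlip hm hφ_lip).mono (by linarith)⟩

end

/-! ### The flow of the velocity field -/

section LinearODE

variable {a : ℝ → ℝ} {τ t : ℝ}

theorem hasDerivAt_primitive (ha : ContinuousOn a (Icc 0 τ)) (ht : t ∈ Ioo 0 τ) :
    HasDerivAt (fun t => ∫ s in (0 : ℝ)..t, a s) (a t) t := by
  have hsub : uIcc 0 t ⊆ Icc 0 τ := by
    rw [uIcc_of_le ht.1.le]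
    exact Icc_subset_Icc_right ht.2.le
  exact intervalIntegral.integral_hasDerivAt_right (ha.mono hsub).intervalIntegrable
    ((ha.mono Ioo_subset_Icc_self).stronglyMeasurableAtFilter isOpen_Ioo t ht)
    (ha.continuousAt (Icc_mem_nhds ht.1 ht.2))

theorem continuousOn_primitive_Icc (hτ : 0 ≤ τ) (ha : ContinuousOn a (Icc 0 τ)) :
    ContinuousOn (fun t => ∫ s in (0 : ℝ)..t, a s) (Icc 0 τ) := by
  rw [← uIcc_of_le hτ] at ha ⊢
  exact intervalIntegral.continuousOn_primitive_interval' ha.intervalIntegrable left_mem_uIcc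

theorem eq_mul_exp_integral {g : ℝ → ℝ} (ha : ContinuousOn a (Icc 0 τ))
    (hg : ContinuousOn g (Icc 0 τ)) (hd : ∀ t ∈ Ioo 0 τ, HasDerivAt g (a t * g t) t)
    (ht : t ∈ Icc 0 τ) : g t = g 0 * Real.exp (∫ s in (0 : ℝ)..t, a s) := by
  have hτ : 0 ≤ τ := ht.1.trans ht.2
  set A : ℝ → ℝ := fun t => ∫ s in (0 : ℝ)..t, a s
  have hcont : ContinuousOn (fun t => g t * Real.exp (-A t)) (Icc 0 t) :=
    (hg.mul (continuousOn_primitive_Icc hτ ha).neg.rexp).mono (Icc_subset_Icc_right ht.2)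
  have hderiv : ∀ s ∈ Ioo 0 t, HasDerivAt (fun t => g t * Real.exp (-A t)) 0 s := by
    intro s hs
    have hs' : s ∈ Ioo 0 τ := ⟨hs.1, hs.2.trans_le ht.2⟩
    exact ((hd s hs').mul (hasDerivAt_primitive ha hs').neg.exp).congr_deriv (by ring)
  have hconst : g t * Real.exp (-A t) = g 0 := by
    rcases ht.1.eq_or_lt with rfl | hpos
    · simp [A]
    obtain ⟨_, _, hslope⟩ := exists_hasDerivAt_eq_slope _ _ hpos hcont hderiv
    rw [eq_comm, sub_zero, div_eq_zero_iff, or_iff_left hpos.ne', sub_eq_zero] at hslope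
    simpa [A] using hslope
  rw [← hconst, mul_assoc, ← Real.exp_add, neg_add_cancel, Real.exp_zero, mul_one]

end LinearODE

section

variable {T τ M t : ℝ} {u : ℝ → ℝ → ℝ} {X Y : ℝ → ℝ}

theorem hasDerivAt_of_isIntegralCurveOn (hX : IsIntegralCurveOn X u (Icc 0 τ))
    (ht : t ∈ Ioo 0 τ) : HasDerivAt X (u t (X t)) t :=
  (hX t (Ioo_subset_Icc_self ht)).hasDerivAt (Icc_mem_nhds ht.1 ht.2)

theorem exists_isIntegralCurveOn (hu : IsClassC1 T u) (hτ : τ < T) {t₀ : ℝ} (ht₀ : t₀ ∈ Icc 0 τ)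
    (x₀ : ℝ) : ∃ X, IsIntegralCurveOn X u (Icc 0 τ) ∧ X t₀ = x₀ := by
  obtain ⟨M, hM₀, hu_le, hu_deriv, -⟩ := hu.exists_bound hτ
  have hsub := Icc_subset_Ico_of_lt hτ
  have hpl : IsPicardLindelof u (⟨t₀, ht₀⟩ : Icc 0 τ) x₀ (M * τ).toNNReal 0 M.toNNReal
      M.toNNReal := by
    refine ⟨fun t ht => LipschitzOnWith.of_dist_le' fun x _ y _ =>
        hu.lipschitz_space (hsub ht) (hu_deriv t ht) x y,
      fun x _ => hu.continuousOn_along hsub continuousOn_const, fun t ht x _ => ?_, ?_⟩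
    · rw [Real.coe_toNNReal _ hM₀]
      exact hu_le t ht x
    · rw [Real.coe_toNNReal _ hM₀, Real.coe_toNNReal _ (mul_nonneg hM₀ (ht₀.1.trans ht₀.2)),
        NNReal.coe_zero, sub_zero, sub_zero]
      exact mul_le_mul_of_nonneg_left (max_le (sub_le_self _ ht₀.1) ht₀.2) hM₀
  obtain ⟨X, hX₀, hX⟩ := hpl.exists_eq_forall_mem_Icc_hasDerivWithinAt₀
  exact ⟨X, hX, hX₀⟩

theorem dist_integralCurve_le (hu : IsClassC1 T u) (hτ : τ < T) (hM₀ : 0 ≤ M)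
    (hM : ∀ t ∈ Icc 0 τ, ∀ x, |deriv (u t) x| ≤ M) (hX : IsIntegralCurveOn X u (Icc 0 τ))
    (hY : IsIntegralCurveOn Y u (Icc 0 τ)) (ht : t ∈ Icc 0 τ) :
    |X t - Y t| ≤ |X 0 - Y 0| * Real.exp (M * t) := by
  have hright : ∀ {Z : ℝ → ℝ}, IsIntegralCurveOn Z u (Icc 0 τ) → ∀ s ∈ Ico 0 τ,
      HasDerivWithinAt Z (u s (Z s)) (Ici s) s := fun hZ s hs =>
    (hZ s (Ico_subset_Icc_self hs)).mono_of_mem_nhdsWithin (Icc_mem_nhdsGE_of_mem hs)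
  have := dist_le_of_trajectories_ODE_of_mem (s := fun _ => univ) (K := M.toNNReal)
    (fun s hs => LipschitzOnWith.of_dist_le' fun x _ y _ => hu.lipschitz_space
      (Icc_subset_Ico_of_lt hτ (Ico_subset_Icc_self hs)) (hM s (Ico_subset_Icc_self hs)) x y)
    hX.continuousOn (hright hX) (fun _ _ => mem_univ _) hY.continuousOn (hright hY)
    (fun _ _ => mem_univ _) le_rfl t ht
  rwa [Real.coe_toNNReal _ hM₀, sub_zero] at this

theorem integralCurve_ne (hu : IsClassC1 T u) (hτ : τ < T)
    (hX : IsIntegralCurveOn X u (Icc 0 τ)) (hY : IsIntegralCurveOn Y u (Icc 0 τ))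
    (hne : X 0 ≠ Y 0) (ht : t ∈ Icc 0 τ) : X t ≠ Y t := by
  obtain ⟨M, -, -, hM, -⟩ := hu.exists_bound hτ
  have hsub : Icc 0 t ⊆ Icc 0 τ := Icc_subset_Icc_right ht.2
  have hleft : ∀ {Z : ℝ → ℝ}, IsIntegralCurveOn Z u (Icc 0 τ) → ∀ s ∈ Ioc 0 t,
      HasDerivWithinAt Z (u s (Z s)) (Iic s) s := fun hZ s hs =>
    (hZ s (hsub (Ioc_subset_Icc_self hs))).mono_of_mem_nhdsWithin
      (Icc_mem_nhdsLE_of_mem ⟨hs.1, hs.2.trans ht.2⟩)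
  intro heq
  exact hne (ODE_solution_unique_of_mem_Icc_left (s := fun _ => univ) (K := M.toNNReal)
    (fun s hs => LipschitzOnWith.of_dist_le' fun x _ y _ => hu.lipschitz_space
      (Icc_subset_Ico_of_lt hτ (hsub (Ioc_subset_Icc_self hs)))
      (hM s (hsub (Ioc_subset_Icc_self hs))) x y)
    (hX.continuousOn.mono hsub) (hleft hX) (fun _ _ => mem_univ _)
    (hY.continuousOn.mono hsub) (hleft hY) (fun _ _ => mem_univ _) heq (left_mem_Icc.2 ht.1))

/-- The factor `y(t) = exp ∫₀ᵗ ∂ₓu(s, X(s)) ds` by which the flow of `u` stretches lengths along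
the characteristic `X`. -/
def stretch (u : ℝ → ℝ → ℝ) (X : ℝ → ℝ) (t : ℝ) : ℝ :=
  Real.exp (∫ s in (0 : ℝ)..t, deriv (u s) (X s))

theorem stretch_zero (u : ℝ → ℝ → ℝ) (X : ℝ → ℝ) : stretch u X 0 = 1 := by simp [stretch]

theorem stretch_pos (u : ℝ → ℝ → ℝ) (X : ℝ → ℝ) (t : ℝ) : 0 < stretch u X t := Real.exp_pos _

theorem continuousOn_stretch (hu : IsClassC1 T u) (hτ₀ : 0 ≤ τ) (hτ : τ < T)
    (hX : ContinuousOn X (Icc 0 τ)) : ContinuousOn (stretch u X) (Icc 0 τ) :=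
  (continuousOn_primitive_Icc hτ₀
    (hu.continuousOn_deriv_along (Icc_subset_Ico_of_lt hτ) hX)).rexp

theorem hasDerivAt_stretch (hu : IsClassC1 T u) (hτ : τ < T) (hX : ContinuousOn X (Icc 0 τ))
    (ht : t ∈ Ioo 0 τ) : HasDerivAt (stretch u X) (deriv (u t) (X t) * stretch u X t) t :=
  (hasDerivAt_primitive (hu.continuousOn_deriv_along (Icc_subset_Ico_of_lt hτ) hX)
    ht).exp.congr_deriv (mul_comm _ _)

end

/-- `Y x` is the characteristic of `u` on `[0,τ]` that starts at `x`. -/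
def IsFlow (τ : ℝ) (u Y : ℝ → ℝ → ℝ) : Prop :=
  ∀ x, IsIntegralCurveOn (Y x) u (Icc 0 τ) ∧ Y x 0 = x

theorem exists_isFlow {T τ : ℝ} {u : ℝ → ℝ → ℝ} (hu : IsClassC1 T u) (hτ₀ : 0 ≤ τ) (hτ : τ < T) :
    ∃ Y, IsFlow τ u Y := by
  choose Y hY using exists_isIntegralCurveOn hu hτ (left_mem_Icc.2 hτ₀)
  exact ⟨Y, hY⟩

theorem abs_dslope_le {f : ℝ → ℝ} {M a : ℝ} (hf : ∀ x y, |f x - f y| ≤ M * |x - y|) {b : ℝ}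
    (hab : b ≠ a) : |dslope f a b| ≤ M := by
  rw [dslope_of_ne f hab, slope_def_field, abs_div, div_le_iff₀ (abs_pos.2 (sub_ne_zero.2 hab))]
  exact hf b a

namespace IsFlow

variable {T τ M t x x₀ : ℝ} {u Y : ℝ → ℝ → ℝ}

theorem abs_sub_le (hY : IsFlow τ u Y) (hu : IsClassC1 T u) (hτ : τ < T) (hM₀ : 0 ≤ M)
    (hM : ∀ t ∈ Icc 0 τ, ∀ x, |deriv (u t) x| ≤ M) (ht : t ∈ Icc 0 τ) (x x' : ℝ) :
    |Y x t - Y x' t| ≤ Real.exp (M * t) * |x - x'| := by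
  have h := dist_integralCurve_le hu hτ hM₀ hM (hY x).1 (hY x').1 ht
  rwa [(hY x).2, (hY x').2, mul_comm] at h

theorem ne (hY : IsFlow τ u Y) (hu : IsClassC1 T u) (hτ : τ < T) (hx : x ≠ x₀)
    (ht : t ∈ Icc 0 τ) : Y x t ≠ Y x₀ t :=
  integralCurve_ne hu hτ (hY x).1 (hY x₀).1 (by rwa [(hY x).2, (hY x₀).2]) ht

theorem continuousOn_dslope (hY : IsFlow τ u Y) (hu : IsClassC1 T u) (hτ : τ < T) (hx : x ≠ x₀) :
    ContinuousOn (fun s => dslope (u s) (Y x₀ s) (Y x s)) (Icc 0 τ) := by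
  have hsub := Icc_subset_Ico_of_lt hτ
  refine ContinuousOn.congr (f := fun s => (u s (Y x s) - u s (Y x₀ s)) / (Y x s - Y x₀ s)) ?_
    fun s hs => by rw [dslope_of_ne _ (hY.ne hu hτ hx hs), slope_def_field]
  exact ((hu.continuousOn_along hsub (hY x).1.continuousOn).sub
    (hu.continuousOn_along hsub (hY x₀).1.continuousOn)).div
    ((hY x).1.continuousOn.sub (hY x₀).1.continuousOn)
    fun s hs => sub_ne_zero.2 (hY.ne hu hτ hx hs)

theorem sub_eq_mul_exp (hY : IsFlow τ u Y) (hu : IsClassC1 T u) (hτ : τ < T) (hx : x ≠ x₀)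
    (ht : t ∈ Icc 0 τ) :
    Y x t - Y x₀ t = (x - x₀) * Real.exp (∫ s in (0 : ℝ)..t, dslope (u s) (Y x₀ s) (Y x s)) := by
  have h := eq_mul_exp_integral (hY.continuousOn_dslope hu hτ hx)
    ((hY x).1.continuousOn.sub (hY x₀).1.continuousOn) (fun s hs => ?_) ht
  · simpa only [Pi.sub_apply, (hY x).2, (hY x₀).2] using h
  · refine ((hasDerivAt_of_isIntegralCurveOn (hY x).1 hs).sub
      (hasDerivAt_of_isIntegralCurveOn (hY x₀).1 hs)).congr_deriv ?_
    rw [Pi.sub_apply, mul_comm, ← smul_eq_mul, sub_smul_dslope]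

theorem hasDerivAt (hY : IsFlow τ u Y) (hu : IsClassC1 T u) (hτ : τ < T) (ht : t ∈ Icc 0 τ)
    (x₀ : ℝ) : HasDerivAt (fun x => Y x t) (stretch u (Y x₀) t) x₀ := by
  obtain ⟨M, hM₀, -, hM, -⟩ := hu.exists_bound hτ
  have hsub := Icc_subset_Ico_of_lt hτ
  have hmem : uIoc 0 t ⊆ Icc 0 τ := by
    rw [uIoc_of_le ht.1]
    exact Ioc_subset_Icc_self.trans (Icc_subset_Icc_right ht.2)
  have hcont : ∀ s ∈ Icc 0 τ, Tendsto (fun x => Y x s) (𝓝 x₀) (𝓝 (Y x₀ s)) := fun s hs =>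
    (LipschitzWith.of_dist_le' fun x x' =>
      hY.abs_sub_le hu hτ hM₀ hM hs x x').continuous.tendsto x₀
  have hlim : Tendsto (fun x => ∫ s in (0 : ℝ)..t, dslope (u s) (Y x₀ s) (Y x s)) (𝓝[≠] x₀)
      (𝓝 (∫ s in (0 : ℝ)..t, deriv (u s) (Y x₀ s))) := by
    refine intervalIntegral.tendsto_integral_filter_of_dominated_convergence (fun _ => M) ?_ ?_
      intervalIntegrable_const (Eventually.of_forall fun s hs => ?_)
    · filter_upwards [self_mem_nhdsWithin] with x hx
      exact ((hY.continuousOn_dslope hu hτ hx).mono hmem).aestronglyMeasurable measurableSet_uIoc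
    · filter_upwards [self_mem_nhdsWithin] with x hx
      exact Eventually.of_forall fun s hs => abs_dslope_le
        (hu.lipschitz_space (hsub (hmem hs)) (hM s (hmem hs))) (hY.ne hu hτ hx (hmem hs))
    · have hdslope := continuousAt_dslope_same.2
        (hu.hasDerivAt_space (hsub (hmem hs)) (Y x₀ s)).differentiableAt
      rw [← dslope_same (u s)]
      exact hdslope.tendsto.comp ((hcont s (hmem hs)).mono_left nhdsWithin_le_nhds)
  refine hasDerivAt_iff_tendsto_slope.2 (((Real.continuous_exp.tendsto _).comp hlim).congr' ?_)
  filter_upwards [self_mem_nhdsWithin] with x hx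
  rw [Function.comp_apply, slope_def_field, hY.sub_eq_mul_exp hu hτ hx ht,
    mul_div_cancel_left₀ _ (sub_ne_zero.2 hx)]

end IsFlow

section

variable {T τ t : ℝ} {ρ₀ u₀ X : ℝ → ℝ} {ρ u φ : ℝ → ℝ → ℝ}

theorem IsClassicalSolution.density_mul_stretch (h : IsClassicalSolution T ρ₀ u₀ ρ u φ)
    (hτ : τ < T) (hX : IsIntegralCurveOn X u (Icc 0 τ)) (ht : t ∈ Icc 0 τ) :
    ρ t (X t) * stretch u X t = ρ₀ (X 0) := by
  have hsub := Icc_subset_Ico_of_lt hτ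
  have hd : ∀ s ∈ Ioo 0 τ,
      HasDerivAt (fun s => ρ s (X s)) (-deriv (u s) (X s) * ρ s (X s)) s := by
    intro s hs
    have hs' : s ∈ Ioo 0 T := ⟨hs.1, hs.2.trans hτ⟩
    refine (h.density_C1.hasDerivAt_along hs'
      (hasDerivAt_of_isIntegralCurveOn hX hs)).congr_deriv ?_
    have hcontinuity := h.continuity s hs' (X s)
    have hprod : deriv (fun y => ρ s y * u s y) (X s) = _ :=
      ((h.density_C1.hasDerivAt_space (Ioo_subset_Ico_self hs') (X s)).mul
        (h.velocity_C1.hasDerivAt_space (Ioo_subset_Ico_self hs') (X s))).deriv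
    rw [hprod] at hcontinuity
    linear_combination hcontinuity
  have hρ := eq_mul_exp_integral
    (h.velocity_C1.continuousOn_deriv_along hsub hX.continuousOn).neg
    (h.density_C1.continuousOn_along hsub hX.continuousOn) hd ht
  rw [Pi.neg_def, intervalIntegral.integral_neg] at hρ
  rw [hρ, stretch, mul_assoc, ← Real.exp_add, neg_add_cancel, Real.exp_zero, mul_one,
    h.density_init]

theorem IsClassicalSolution.density_nonneg (h : IsClassicalSolution T ρ₀ u₀ ρ u φ)
    (hρ₀ : ∀ x, 0 ≤ ρ₀ x) (ht : t ∈ Ico 0 T) (x : ℝ) : 0 ≤ ρ t x := by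
  obtain ⟨X, hX, hXt⟩ := exists_isIntegralCurveOn h.velocity_C1 ht.2 ⟨ht.1, le_rfl⟩ x
  have hmass := h.density_mul_stretch ht.2 hX ⟨ht.1, le_rfl⟩
  rw [hXt] at hmass
  exact nonneg_of_mul_nonneg_left (hmass ▸ hρ₀ (X 0)) (stretch_pos u X t)

end

/-! ### The functions `V₊` and `V₋` -/

theorem continuous_U : Continuous U := by
  unfold U
  fun_prop

theorem U_nonneg (r : ℝ) : 0 ≤ U r := by
  have := exp_mul_sub_le 0 r
  rw [Real.exp_zero] at this
  unfold U
  linarith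

theorem U_pos {r : ℝ} (hr : r ≠ 0) : 0 < U r := by
  have hlt := mul_lt_mul_of_pos_left (Real.add_one_lt_exp (neg_ne_zero.2 hr)) (Real.exp_pos r)
  rw [← Real.exp_add, add_neg_cancel, Real.exp_zero] at hlt
  unfold U
  linarith

theorem continuous_sqrt_two_mul_U : Continuous fun r => √(2 * U r) :=
  (continuous_const.mul continuous_U).sqrt

theorem hasDerivAt_Vplus (z : ℝ) : HasDerivAt Vplus √(2 * U z) z :=
  intervalIntegral.integral_hasDerivAt_right
    (continuous_sqrt_two_mul_U.intervalIntegrable _ _)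
    (continuous_sqrt_two_mul_U.stronglyMeasurableAtFilter _ _)
    continuous_sqrt_two_mul_U.continuousAt

theorem continuous_Vplus : Continuous Vplus :=
  continuous_iff_continuousAt.2 fun z => (hasDerivAt_Vplus z).continuousAt

theorem Vplus_zero : Vplus 0 = 0 := intervalIntegral.integral_same

theorem Vminus_eq (z : ℝ) : Vminus z = -Vplus z := intervalIntegral.integral_symm _ _

theorem strictMonoOn_Vplus {D : Set ℝ} (hD : Convex ℝ D) (h0 : (0 : ℝ) ∉ interior D) :
    StrictMonoOn Vplus D :=
  strictMonoOn_of_hasDerivWithinAt_pos hD continuous_Vplus.continuousOn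
    (fun z _ => (hasDerivAt_Vplus z).hasDerivWithinAt)
    fun _ hz => Real.sqrt_pos.2 (mul_pos two_pos (U_pos (ne_of_mem_of_not_mem hz h0)))

theorem strictMonoOn_Vplus_Ici : StrictMonoOn Vplus (Ici 0) :=
  strictMonoOn_Vplus (convex_Ici 0) (by simp)

theorem strictMonoOn_Vplus_Iic : StrictMonoOn Vplus (Iic 0) :=
  strictMonoOn_Vplus (convex_Iic 0) (by simp)

theorem sub_le_Vplus_sub {a b : ℝ} (hab : a ≤ b) (hU : ∀ x ∈ Icc a b, 1 ≤ 2 * U x) :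
    b - a ≤ Vplus b - Vplus a := by
  have hmono : MonotoneOn (fun z => Vplus z - z) (Icc a b) :=
    monotoneOn_of_hasDerivWithinAt_nonneg (convex_Icc a b)
      (continuous_Vplus.sub continuous_id).continuousOn
      (fun z _ => ((hasDerivAt_Vplus z).sub (hasDerivAt_id z)).hasDerivWithinAt)
      fun z hz => sub_nonneg.2 (Real.one_le_sqrt.2 (hU z (interior_subset hz)))
  have := hmono (left_mem_Icc.2 hab) (right_mem_Icc.2 hab) hab
  dsimp only at this
  linarith

theorem one_le_two_mul_U_of_one_le {x : ℝ} (hx : 1 ≤ x) : 1 ≤ 2 * U x := by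
  have := mul_nonneg (sub_nonneg.2 hx) (Real.exp_pos x).le
  unfold U
  linarith

theorem one_le_two_mul_U_of_le_neg_three {x : ℝ} (hx : x ≤ -3) : 1 ≤ 2 * U x := by
  have hexp : 2 * (1 - x) ≤ Real.exp (-x) := by
    nlinarith [Real.quadratic_le_exp_of_nonneg (show 0 ≤ -x by linarith)]
  have hmul := mul_le_mul_of_nonneg_left hexp (Real.exp_pos x).le
  rw [← Real.exp_add, add_neg_cancel, Real.exp_zero] at hmul
  unfold U
  linarith

theorem exists_Vplus_eq {H : ℝ} (hH : 0 ≤ H) : ∃ z ∈ Ici (0 : ℝ), Vplus z = H := by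
  have hgrow := sub_le_Vplus_sub (show 1 ≤ 1 + H by linarith)
    fun x hx => one_le_two_mul_U_of_one_le hx.1
  have hone := strictMonoOn_Vplus_Ici.monotoneOn self_mem_Ici (mem_Ici.2 zero_le_one) zero_le_one
  rw [Vplus_zero] at hone
  obtain ⟨z, hz, hzH⟩ := intermediate_value_Icc (show 0 ≤ 1 + H by linarith)
    continuous_Vplus.continuousOn ⟨Vplus_zero.trans_le hH, show H ≤ Vplus (1 + H) by linarith⟩
  exact ⟨z, hz.1, hzH⟩

theorem exists_Vminus_eq {H : ℝ} (hH : 0 ≤ H) : ∃ z ∈ Iic (0 : ℝ), Vminus z = H := by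
  have hgrow := sub_le_Vplus_sub (show -3 - H ≤ -3 by linarith)
    fun x hx => one_le_two_mul_U_of_le_neg_three hx.2
  have hthree := strictMonoOn_Vplus_Iic.monotoneOn (show (-3 : ℝ) ∈ Iic 0 by norm_num)
    self_mem_Iic (by norm_num)
  rw [Vplus_zero] at hthree
  obtain ⟨z, hz, hzH⟩ := intermediate_value_Icc (show -3 - H ≤ 0 by linarith)
    continuous_Vplus.continuousOn (show -H ∈ Icc (Vplus (-3 - H)) (Vplus 0) from
      ⟨by linarith, by rw [Vplus_zero]; linarith⟩)
  exact ⟨z, hz.2, by rw [Vminus_eq, hzH, neg_neg]⟩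

theorem exp_le_cplus {H a : ℝ} (hH : 0 ≤ H) (ha : Vplus a ≤ H) : Real.exp a ≤ cplus H := by
  have hmem := Function.invFunOn_mem (exists_Vplus_eq hH)
  have heq := Function.invFunOn_eq (exists_Vplus_eq hH)
  refine Real.exp_le_exp.2 (le_of_not_gt fun hlt => ?_)
  have := strictMonoOn_Vplus_Ici hmem ((mem_Ici.1 hmem).trans hlt.le) hlt
  linarith

theorem cminus_le_exp {H a : ℝ} (hH : 0 ≤ H) (ha : -H ≤ Vplus a) : cminus H ≤ Real.exp a := by
  have hmem := Function.invFunOn_mem (exists_Vminus_eq hH)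
  have heq := Function.invFunOn_eq (exists_Vminus_eq hH)
  rw [Vminus_eq] at heq
  refine Real.exp_le_exp.2 (le_of_not_gt fun hlt => ?_)
  have := strictMonoOn_Vplus_Iic (hlt.le.trans (mem_Iic.1 hmem)) hmem hlt
  linarith

/-- The electric part `½ |φ'|² + U(φ)` of the energy density. -/
def fieldEnergyDensity (φ : ℝ → ℝ) (x : ℝ) : ℝ := 1 / 2 * deriv φ x ^ 2 + U (φ x)

theorem fieldEnergyDensity_nonneg (φ : ℝ → ℝ) (x : ℝ) : 0 ≤ fieldEnergyDensity φ x :=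
  add_nonneg (by positivity) (U_nonneg _)

namespace IsPotential

variable {ρ φ : ℝ → ℝ}

theorem continuous_fieldEnergyDensity (h : IsPotential ρ φ) :
    Continuous (fieldEnergyDensity φ) :=
  (continuous_const.mul (h.continuous_deriv.pow 2)).add (continuous_U.comp h.continuous)

theorem abs_Vplus_sub_le (h : IsPotential ρ φ) {a b : ℝ} (hab : a ≤ b) :
    |Vplus (φ b) - Vplus (φ a)| ≤ ∫ x in a..b, fieldEnergyDensity φ x := by
  set v : ℝ → ℝ := fun x => √(2 * U (φ x)) * deriv φ x
  have hv : Continuous v :=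
    (continuous_sqrt_two_mul_U.comp h.continuous).mul h.continuous_deriv
  have hv_le : ∀ x, |v x| ≤ fieldEnergyDensity φ x := by
    intro x
    have hsq := Real.sq_sqrt (mul_nonneg zero_le_two (U_nonneg (φ x)))
    have hamgm := two_mul_le_add_sq √(2 * U (φ x)) |deriv φ x|
    rw [hsq, sq_abs] at hamgm
    rw [abs_mul, abs_of_nonneg (Real.sqrt_nonneg _), fieldEnergyDensity]
    linarith
  rw [← intervalIntegral.integral_eq_sub_of_hasDerivAt (f := fun x => Vplus (φ x))
    (fun x _ => (hasDerivAt_Vplus (φ x)).comp x (h.hasDerivAt x)) (hv.intervalIntegrable a b)]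
  exact (intervalIntegral.abs_integral_le_integral_abs hab).trans
    (intervalIntegral.integral_mono_on hab (hv.abs.intervalIntegrable a b)
      (h.continuous_fieldEnergyDensity.intervalIntegrable a b) fun x _ => hv_le x)

theorem abs_Vplus_le (h : IsPotential ρ φ) {H : ℝ}
    (hH : ∀ ε > 0, ∀ᶠ R in atTop, ∫ x in (-R)..R, fieldEnergyDensity φ x ≤ H + ε) (x : ℝ) :
    |Vplus (φ x)| ≤ H := by
  refine le_of_forall_pos_le_add fun ε hε => ?_
  have hlim : Tendsto (fun R : ℝ => |Vplus (φ x) - Vplus (φ (-R))|) atTop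
      (𝓝 |Vplus (φ x) - Vplus 0|) := by
    have hφ : Tendsto (fun R : ℝ => φ (-R)) atTop (𝓝 0) :=
      h.decay.comp (tendsto_neg_atTop_atBot.mono_right atBot_le_cocompact)
    exact (tendsto_const_nhds.sub ((continuous_Vplus.tendsto 0).comp hφ)).abs
  rw [Vplus_zero, sub_zero] at hlim
  refine le_of_tendsto hlim ?_
  filter_upwards [hH ε hε, eventually_ge_atTop |x|] with R hR hxR
  obtain ⟨hleft, hright⟩ := abs_le.1 hxR
  refine ((h.abs_Vplus_sub_le hleft).trans ?_).trans hR
  exact intervalIntegral.integral_mono_interval le_rfl hleft hright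
    (Eventually.of_forall (fieldEnergyDensity_nonneg φ))
    (h.continuous_fieldEnergyDensity.intervalIntegrable _ _)

end IsPotential

/-! ### The energy inequality -/

theorem le_add_mul_of_increment_le {f : ℝ → ℝ} {a b κ : ℝ} (hab : a < b)
    (hf : ContinuousOn f (Icc a b))
    (hd : ∀ s ∈ Ioo a b, ∃ g c, HasDerivAt g c s ∧ c ≤ κ ∧ ∀ t ∈ Ioo s b, f t - f s ≤ g t - g s) :
    f b ≤ f a + κ * (b - a) := by
  have hinterior : ∀ a' ∈ Ioo a b, f b ≤ f a' + κ * (b - a') := by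
    intro a' ha'
    refine image_le_of_liminf_slope_right_le_deriv_boundary
      (B := fun x => f a' + κ * (x - a')) (B' := fun _ => κ)
      (hf.mono (Icc_subset_Icc_left ha'.1.le)) (by simp) (by fun_prop) (fun x _ => ?_)
      (fun s hs r hr => ?_) (right_mem_Icc.2 ha'.2.le)
    · exact ((((hasDerivAt_id x).sub_const a').const_mul κ).const_add (f a')).congr_deriv
        (mul_one κ) |>.hasDerivWithinAt
    · obtain ⟨g, c, hg, hc, hle⟩ := hd s ⟨ha'.1.trans_le hs.1, hs.2⟩
      have hslope := (hasDerivAt_iff_tendsto_slope.1 hg).mono_left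
        (nhdsWithin_mono s fun y (hy : s < y) => hy.ne')
      refine Eventually.frequently ?_
      filter_upwards [hslope.eventually_lt_const (hc.trans_lt hr), Ioo_mem_nhdsGT hs.2]
        with z hz hzs
      rw [slope_def_field] at hz ⊢
      exact (div_le_div_of_nonneg_right (hle z hzs) (sub_nonneg.2 hzs.1.le)).trans_lt hz
  have hlim : Tendsto (fun a' => f a' + κ * (b - a')) (𝓝[>] a) (𝓝 (f a + κ * (b - a))) := by
    rw [← nhdsWithin_Ioo_eq_nhdsGT hab]
    have hcont : ContinuousOn (fun a' => f a' + κ * (b - a')) (Icc a b) := hf.add (by fun_prop)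
    exact (hcont a (left_mem_Icc.2 hab.le)).mono Ioo_subset_Icc_self
  exact ge_of_tendsto hlim (by filter_upwards [Ioo_mem_nhdsGT hab] with c hc using hinterior c hc)

theorem continuousOn_integral_of_continuousOn_prod {F : ℝ → ℝ → ℝ} {S : Set ℝ}
    (hF : ContinuousOn (fun p : ℝ × ℝ => F p.1 p.2) (S ×ˢ univ)) (a b : ℝ) :
    ContinuousOn (fun t => ∫ x in a..b, F t x) S := by
  rw [continuousOn_iff_continuous_domRestrict]
  exact intervalIntegral.continuous_parametric_intervalIntegral_of_continuous'
    (f := fun (t : S) x => F t x) (hF.comp_continuous (f := fun p : S × ℝ => ((p.1 : ℝ), p.2))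
      (by fun_prop) fun p => ⟨p.1.2, mem_univ _⟩) a b

theorem integral_deriv_of_contDiff {f : ℝ → ℝ} (hf : ContDiff ℝ 1 f) (a b : ℝ) :
    ∫ x in a..b, deriv f x = f b - f a :=
  intervalIntegral.integral_deriv_eq_sub (fun x _ => hf.differentiable one_ne_zero x)
    ((hf.continuous_deriv le_rfl).intervalIntegrable a b)

/-- Common bounds on `[0,τ] × ℝ` for a solution and its potential, and common Lipschitz constants
in time. -/
structure UniformBounds (τ C : ℝ) (ρ u φ : ℝ → ℝ → ℝ) : Prop where
  nonneg : 0 ≤ C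
  density : ∀ t ∈ Icc 0 τ, ∀ x, |ρ t x| ≤ C
  velocity : ∀ t ∈ Icc 0 τ, ∀ x, |u t x| ≤ C
  velocity_deriv : ∀ t ∈ Icc 0 τ, ∀ x, |deriv (u t) x| ≤ C
  potential : ∀ t ∈ Icc 0 τ, ∀ x, |φ t x| ≤ C
  density_lip : TimeLipschitz C (Icc 0 τ) ρ
  velocity_lip : TimeLipschitz C (Icc 0 τ) u
  potential_lip : TimeLipschitz C (Icc 0 τ) φ
  field_lip : TimeLipschitz C (Icc 0 τ) fun t => deriv (φ t)

/-- The energy density `ρ (½ u² + ψ)` of a fluid in a prescribed potential `ψ`. -/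
def fluidEnergyDensity (ρ u ψ : ℝ → ℝ) (x : ℝ) : ℝ := ρ x * (1 / 2 * u x ^ 2 + ψ x)

theorem abs_half_sq_add_le {C v p : ℝ} (hv : |v| ≤ C) (hp : |p| ≤ C) :
    |1 / 2 * v ^ 2 + p| ≤ 1 / 2 * C ^ 2 + C := by
  have hsq : 0 ≤ 1 / 2 * v ^ 2 := by positivity
  calc |1 / 2 * v ^ 2 + p| ≤ |1 / 2 * v ^ 2| + |p| := abs_add_le _ _
    _ = 1 / 2 * |v| ^ 2 + |p| := by rw [abs_of_nonneg hsq, sq_abs]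
    _ ≤ 1 / 2 * C ^ 2 + C := by gcongr

section

variable {τ C : ℝ} {ρ u φ : ℝ → ℝ → ℝ} {ψ : ℝ → ℝ}

theorem UniformBounds.exists_timeLipschitz_fluidEnergyDensity (hC : UniformBounds τ C ρ u φ)
    (hψ : ∀ x, |ψ x| ≤ C) :
    ∃ L, TimeLipschitz L (Icc 0 τ) fun t => fluidEnergyDensity (ρ t) (u t) ψ := by
  have hlip : TimeLipschitz (C * C) (Icc 0 τ) fun t x => 1 / 2 * u t x ^ 2 + ψ x := by
    intro s hs t ht x
    have hmean : |1 / 2 * (u t x + u s x)| ≤ C := by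
      have ht_le := abs_le.1 (hC.velocity t ht x)
      have hs_le := abs_le.1 (hC.velocity s hs x)
      exact abs_le.2 ⟨by linarith [ht_le.1, hs_le.1], by linarith [ht_le.2, hs_le.2]⟩
    calc |1 / 2 * u t x ^ 2 + ψ x - (1 / 2 * u s x ^ 2 + ψ x)|
        = |1 / 2 * (u t x + u s x)| * |u t x - u s x| := by rw [← abs_mul]; ring_nf
      _ ≤ C * (C * |t - s|) :=
        mul_le_mul hmean (hC.velocity_lip s hs t ht x) (abs_nonneg _) hC.nonneg
      _ = C * C * |t - s| := by ring
  exact ⟨_, hC.density_lip.mul hlip hC.density fun t ht x =>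
    abs_half_sq_add_le (hC.velocity t ht x) (hψ x)⟩

theorem UniformBounds.abs_mul_fluidEnergyDensity_le (hC : UniformBounds τ C ρ u φ) {t x η : ℝ}
    (ht : t ∈ Icc 0 τ) (hu : |u t x| ≤ η) :
    |u t x * fluidEnergyDensity (ρ t) (u t) (φ t) x| ≤ η * (C * (1 / 2 * C ^ 2 + C)) := by
  have hC₀ := hC.nonneg
  have hη : 0 ≤ η := (abs_nonneg _).trans hu
  rw [fluidEnergyDensity, abs_mul, abs_mul]
  gcongr
  exacts [hC.density t ht x, abs_half_sq_add_le (hC.velocity t ht x) (hC.potential t ht x)]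

end

theorem IsPotential.fieldEnergyDensity_sub_le {ρ₁ ρ₂ φ₁ φ₂ : ℝ → ℝ} (h₁ : IsPotential ρ₁ φ₁)
    (h₂ : IsPotential ρ₂ φ₂) (x : ℝ) :
    fieldEnergyDensity φ₁ x - fieldEnergyDensity φ₂ x
      ≤ deriv (fun y => φ₁ y * (deriv φ₁ y - deriv φ₂ y)) x + φ₁ x * (ρ₁ x - ρ₂ x) := by
  have hd : deriv (fun y => φ₁ y * (deriv φ₁ y - deriv φ₂ y)) x = _ :=
    ((h₁.hasDerivAt x).mul ((h₁.hasDerivAt_deriv x).sub (h₂.hasDerivAt_deriv x))).deriv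
  rw [hd, Pi.sub_apply]
  unfold fieldEnergyDensity U
  nlinarith [sq_nonneg (deriv φ₁ x - deriv φ₂ x), exp_mul_sub_le (φ₁ x) (φ₂ x)]

section

variable {T τ C : ℝ} {ρ₀ u₀ φ₀ : ℝ → ℝ} {ρ u φ : ℝ → ℝ → ℝ}

namespace IsClassicalSolution

theorem exists_uniformBounds (h : IsClassicalSolution T ρ₀ u₀ ρ u φ) (hτ : τ < T) :
    ∃ C, UniformBounds τ C ρ u φ := by
  obtain ⟨M, hM₀, hρ, -, hρ_lip⟩ := h.density_C1.exists_bound hτ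
  obtain ⟨N, hN₀, hu, hu_deriv, hu_lip⟩ := h.velocity_C1.exists_bound hτ
  obtain ⟨B, hB₀, hφ, hφ_lip, hfield_lip⟩ := exists_potential_bounds
    (fun t ht => h.potential t (Icc_subset_Ico_of_lt hτ ht)) hM₀ hρ hρ_lip
  have hM : M ≤ M + N + B := by linarith
  have hN : N ≤ M + N + B := by linarith
  have hB : B ≤ M + N + B := by linarith
  exact ⟨M + N + B, by positivity, fun t ht x => (hρ t ht x).trans hM,
    fun t ht x => (hu t ht x).trans hN, fun t ht x => (hu_deriv t ht x).trans hN,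
    fun t ht x => (hφ t ht x).trans hB, hρ_lip.mono hM, hu_lip.mono hN, hφ_lip.mono hB,
    hfield_lip.mono hB⟩

theorem contDiff_fluidEnergyDensity (h : IsClassicalSolution T ρ₀ u₀ ρ u φ) {t s : ℝ}
    (ht : t ∈ Ico 0 T) (hs : s ∈ Ico 0 T) :
    ContDiff ℝ 1 (fluidEnergyDensity (ρ t) (u t) (φ s)) :=
  (h.density_C1.contDiff_space ht).mul
    ((contDiff_const.mul ((h.velocity_C1.contDiff_space ht).pow 2)).add
      ((h.potential s hs).contDiff.of_le one_le_two))

theorem hasDerivAt_fluidEnergyDensity (h : IsClassicalSolution T ρ₀ u₀ ρ u φ) {s : ℝ}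
    (hs : s ∈ Ioo 0 T) (x : ℝ) :
    HasDerivAt (fun t => fluidEnergyDensity (ρ t) (u t) (φ s) x)
      (-deriv (fun y => u s y * fluidEnergyDensity (ρ s) (u s) (φ s) y) x) s := by
  have hs' := Ioo_subset_Ico_self hs
  have hρ := h.density_C1.hasDerivAt_space hs' x
  have hu := h.velocity_C1.hasDerivAt_space hs' x
  have hφ := (h.potential s hs').hasDerivAt x
  have hflux : deriv (fun y => u s y * fluidEnergyDensity (ρ s) (u s) (φ s) y) x = _ :=
    (hu.mul (hρ.mul (((hu.pow 2).const_mul (1 / 2)).add hφ))).deriv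
  have hmass : deriv (fun y => ρ s y * u s y) x = _ := (hρ.mul hu).deriv
  have hcontinuity := h.continuity s hs x
  rw [hmass] at hcontinuity
  refine ((h.density_C1.hasDerivAt_time hs x).mul
    ((((h.velocity_C1.hasDerivAt_time hs x).pow 2).const_mul (1 / 2)).add_const (φ s x)))
    |>.congr_deriv ?_
  rw [hflux]
  simp only [Pi.add_apply, Pi.mul_apply, Pi.pow_apply]
  linear_combination (1 / 2 * u s x ^ 2 + φ s x) * hcontinuity
    + ρ s x * u s x * h.momentum s hs x

theorem hasDerivAt_integral_fluidEnergyDensity (h : IsClassicalSolution T ρ₀ u₀ ρ u φ)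
    (hτ : τ < T) (hC : UniformBounds τ C ρ u φ) {s : ℝ} (hs : s ∈ Ioo 0 τ) (a b : ℝ) :
    HasDerivAt (fun t => ∫ x in a..b, fluidEnergyDensity (ρ t) (u t) (φ s) x)
      (u s a * fluidEnergyDensity (ρ s) (u s) (φ s) a
        - u s b * fluidEnergyDensity (ρ s) (u s) (φ s) b) s := by
  have hsub := Icc_subset_Ico_of_lt hτ
  have hsI := Ioo_subset_Icc_self hs
  have hflux : ContDiff ℝ 1 fun y => u s y * fluidEnergyDensity (ρ s) (u s) (φ s) y :=
    (h.velocity_C1.contDiff_space (hsub hsI)).mul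
      (h.contDiff_fluidEnergyDensity (hsub hsI) (hsub hsI))
  obtain ⟨L, hL⟩ := hC.exists_timeLipschitz_fluidEnergyDensity (hC.potential s hsI)
  refine (hL.hasDerivAt_integral (a := a) (b := b) (Icc_mem_nhds hs.1 hs.2)
    (fun t ht => (h.contDiff_fluidEnergyDensity (hsub ht) (hsub hsI)).continuous)
    (h.hasDerivAt_fluidEnergyDensity ⟨hs.1, hs.2.trans hτ⟩)
    (hflux.continuous_deriv le_rfl).neg).congr_deriv ?_
  rw [intervalIntegral.integral_neg, integral_deriv_of_contDiff hflux, neg_sub]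

theorem continuousOn_energyDensity (h : IsClassicalSolution T ρ₀ u₀ ρ u φ) (hτ : τ < T)
    (hC : UniformBounds τ C ρ u φ) :
    ContinuousOn (fun p : ℝ × ℝ => energyDensity (ρ p.1) (u p.1) (φ p.1) p.2)
      (Icc 0 τ ×ˢ univ) := by
  have hsub := Icc_subset_Ico_of_lt hτ
  have hsub' := prod_mono hsub (subset_refl (univ : Set ℝ))
  have hφ := hC.potential_lip.continuousOn_prod fun t ht => (h.potential t (hsub ht)).continuous
  have hfield := hC.field_lip.continuousOn_prod
    fun t ht => (h.potential t (hsub ht)).continuous_deriv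
  exact (((continuousOn_const.mul (h.density_C1.1.continuousOn.mono hsub')).mul
    ((h.velocity_C1.1.continuousOn.mono hsub').pow 2)).add
    (continuousOn_const.mul (hfield.pow 2))).add (continuous_U.comp_continuousOn hφ)

theorem continuous_energyDensity (h : IsClassicalSolution T ρ₀ u₀ ρ u φ) {t : ℝ}
    (ht : t ∈ Ico 0 T) : Continuous (energyDensity (ρ t) (u t) (φ t)) := by
  obtain ⟨C, hC⟩ := h.exists_uniformBounds ht.2
  exact (h.continuousOn_energyDensity ht.2 hC).comp_continuous (f := fun x => (t, x))
    (by fun_prop) fun _ => ⟨⟨ht.1, le_rfl⟩, mem_univ _⟩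

-- The potential at time `t` is replaced by the one at time `s` in the fluid energy, which costs
-- only `O((t - s)²)`: this keeps the time derivative of the field out of the energy balance.
theorem energyDensity_sub_le (h : IsClassicalSolution T ρ₀ u₀ ρ u φ) (hτ : τ < T)
    (hC : UniformBounds τ C ρ u φ) {s t : ℝ} (hs : s ∈ Icc 0 τ) (ht : t ∈ Icc 0 τ) (x : ℝ) :
    energyDensity (ρ t) (u t) (φ t) x - energyDensity (ρ s) (u s) (φ s) x
      ≤ fluidEnergyDensity (ρ t) (u t) (φ s) x - fluidEnergyDensity (ρ s) (u s) (φ s) x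
        + deriv (fun y => φ t y * (deriv (φ t) y - deriv (φ s) y)) x + C ^ 2 * (t - s) ^ 2 := by
  have hsub := Icc_subset_Ico_of_lt hτ
  have hfield := (h.potential t (hsub ht)).fieldEnergyDensity_sub_le (h.potential s (hsub hs)) x
  have hquad : (φ t x - φ s x) * (ρ t x - ρ s x) ≤ C ^ 2 * (t - s) ^ 2 :=
    calc (φ t x - φ s x) * (ρ t x - ρ s x) ≤ |φ t x - φ s x| * |ρ t x - ρ s x| := by
          rw [← abs_mul]; exact le_abs_self _
      _ ≤ (C * |t - s|) * (C * |t - s|) :=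
        mul_le_mul (hC.potential_lip s hs t ht x) (hC.density_lip s hs t ht x) (abs_nonneg _)
          (mul_nonneg hC.nonneg (abs_nonneg _))
      _ = C ^ 2 * (t - s) ^ 2 := by rw [← sq_abs (t - s)]; ring
  unfold fieldEnergyDensity at hfield
  unfold energyDensity fluidEnergyDensity
  linarith

theorem integral_energyDensity_sub_le (h : IsClassicalSolution T ρ₀ u₀ ρ u φ) (hτ : τ < T)
    (hC : UniformBounds τ C ρ u φ) {s t : ℝ} (hs : s ∈ Icc 0 τ) (ht : t ∈ Icc 0 τ) {a b : ℝ}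
    (hab : a ≤ b) :
    (∫ x in a..b, energyDensity (ρ t) (u t) (φ t) x)
        - ∫ x in a..b, energyDensity (ρ s) (u s) (φ s) x
      ≤ (∫ x in a..b, fluidEnergyDensity (ρ t) (u t) (φ s) x)
        - (∫ x in a..b, fluidEnergyDensity (ρ s) (u s) (φ s) x)
        + (φ t b * (deriv (φ t) b - deriv (φ s) b) - φ t a * (deriv (φ t) a - deriv (φ s) a))
        + (b - a) * (C ^ 2 * (t - s) ^ 2) := by
  have hsub := Icc_subset_Ico_of_lt hτ
  have hint : ∀ {f : ℝ → ℝ}, Continuous f → IntervalIntegrable f volume a b :=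
    fun hf => hf.intervalIntegrable a b
  have het := hint (h.continuous_energyDensity (hsub ht))
  have hes := hint (h.continuous_energyDensity (hsub hs))
  have hft := hint (h.contDiff_fluidEnergyDensity (hsub ht) (hsub hs)).continuous
  have hfs := hint (h.contDiff_fluidEnergyDensity (hsub hs) (hsub hs)).continuous
  have hbdry : ContDiff ℝ 1 fun y => φ t y * (deriv (φ t) y - deriv (φ s) y) :=
    ((h.potential t (hsub ht)).contDiff.of_le one_le_two).mul
      ((h.potential t (hsub ht)).contDiff_deriv.sub (h.potential s (hsub hs)).contDiff_deriv)
  have hb := hint (hbdry.continuous_deriv le_rfl)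
  have hmono := intervalIntegral.integral_mono_on hab (het.sub hes)
    (((hft.sub hfs).add hb).add intervalIntegrable_const)
    fun x _ => h.energyDensity_sub_le hτ hC hs ht x
  rwa [intervalIntegral.integral_sub het hes,
    intervalIntegral.integral_add ((hft.sub hfs).add hb) intervalIntegrable_const,
    intervalIntegral.integral_add (hft.sub hfs) hb, intervalIntegral.integral_sub hft hfs,
    integral_deriv_of_contDiff hbdry, intervalIntegral.integral_const, smul_eq_mul] at hmono

theorem integral_energyDensity_le_add (h : IsClassicalSolution T ρ₀ u₀ ρ u φ) (hτ₀ : 0 < τ)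
    (hτ : τ < T) (hC : UniformBounds τ C ρ u φ) {a b η : ℝ} (hab : a ≤ b)
    (hu : ∀ t ∈ Icc 0 τ, |u t a| ≤ η ∧ |u t b| ≤ η)
    (hφ : ∀ t ∈ Icc 0 τ, |φ t a| ≤ η ∧ |φ t b| ≤ η) :
    ∫ x in a..b, energyDensity (ρ τ) (u τ) (φ τ) x
      ≤ (∫ x in a..b, energyDensity (ρ 0) (u 0) (φ 0) x)
        + 2 * η * (C * (1 / 2 * C ^ 2 + C) + C) * τ := by
  have hgrowth := le_add_mul_of_increment_le hτ₀ (κ := 2 * η * (C * (1 / 2 * C ^ 2 + C) + C))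
    (continuousOn_integral_of_continuousOn_prod
      (F := fun t => energyDensity (ρ t) (u t) (φ t)) (h.continuousOn_energyDensity hτ hC) a b)
    fun s hs => ?_
  · rwa [sub_zero] at hgrowth
  have hsI : s ∈ Icc 0 τ := Ioo_subset_Icc_self hs
  have hlin : HasDerivAt (fun t : ℝ => t - s) 1 s := (hasDerivAt_id s).sub_const s
  refine ⟨fun t => (∫ x in a..b, fluidEnergyDensity (ρ t) (u t) (φ s) x)
      + 2 * η * C * (t - s) + (b - a) * (C ^ 2 * (t - s) ^ 2), _,
    ((h.hasDerivAt_integral_fluidEnergyDensity hτ hC hs a b).add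
      (hlin.const_mul (2 * η * C))).add (((hlin.pow 2).const_mul (C ^ 2)).const_mul (b - a)),
    ?_, fun t ht => ?_⟩
  · have ha := abs_le.1 (hC.abs_mul_fluidEnergyDensity_le hsI (hu s hsI).1)
    have hb := abs_le.1 (hC.abs_mul_fluidEnergyDensity_le hsI (hu s hsI).2)
    norm_num only [sub_self]
    linarith [ha.2, hb.1]
  · have htI : t ∈ Icc 0 τ := ⟨hs.1.le.trans ht.1.le, ht.2.le⟩
    have hbdry : ∀ y, |φ t y| ≤ η →
        |φ t y * (deriv (φ t) y - deriv (φ s) y)| ≤ η * (C * (t - s)) := by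
      intro y hy
      have hlip := hC.field_lip s hsI t htI y
      rw [abs_of_pos (sub_pos.2 ht.1)] at hlip
      rw [abs_mul]
      exact mul_le_mul hy hlip (abs_nonneg _) ((abs_nonneg _).trans hy)
    have ha := abs_le.1 (hbdry a (hφ t htI).1)
    have hb := abs_le.1 (hbdry b (hφ t htI).2)
    have hsub_le := h.integral_energyDensity_sub_le hτ hC hsI htI hab
    norm_num only [sub_self]
    linarith [ha.1, hb.2]

theorem initial_eq (h : IsClassicalSolution T ρ₀ u₀ ρ u φ) (hφ₀ : IsPotential ρ₀ φ₀) :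
    ρ 0 = ρ₀ ∧ u 0 = u₀ ∧ φ 0 = φ₀ := by
  have hρ : ρ 0 = ρ₀ := funext h.density_init
  have hφ := h.potential 0 ⟨le_rfl, h.pos⟩
  rw [hρ] at hφ
  exact ⟨hρ, funext h.velocity_init, hφ.unique hφ₀⟩

end IsClassicalSolution

theorem fieldEnergyDensity_le_energyDensity {ρ u φ : ℝ → ℝ} {x : ℝ} (hρ : 0 ≤ ρ x) :
    fieldEnergyDensity φ x ≤ energyDensity ρ u φ x := by
  have : 0 ≤ 1 / 2 * ρ x * u x ^ 2 := by positivity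
  unfold fieldEnergyDensity energyDensity
  linarith

theorem energyDensity_nonneg {ρ u φ : ℝ → ℝ} {x : ℝ} (hρ : 0 ≤ ρ x) :
    0 ≤ energyDensity ρ u φ x :=
  (fieldEnergyDensity_nonneg φ x).trans (fieldEnergyDensity_le_energyDensity hρ)

theorem energy_nonneg (hρ₀ : ∀ x, 0 ≤ ρ₀ x) : 0 ≤ energy ρ₀ u₀ φ₀ :=
  integral_nonneg fun x => energyDensity_nonneg (hρ₀ x)

namespace IsClassicalSolution

theorem eventually_integral_energyDensity_le (h : IsClassicalSolution T ρ₀ u₀ ρ u φ)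
    (hρ₀ : ∀ x, 0 ≤ ρ₀ x) (hφ₀ : IsPotential ρ₀ φ₀)
    (hH₀ : Integrable (energyDensity ρ₀ u₀ φ₀)) (hτ : τ ∈ Ioo 0 T) {ε : ℝ} (hε : 0 < ε) :
    ∀ᶠ R in atTop, ∫ x in (-R)..R, energyDensity (ρ τ) (u τ) (φ τ) x ≤ energy ρ₀ u₀ φ₀ + ε := by
  obtain ⟨C, hC⟩ := h.exists_uniformBounds hτ.2
  have hsub := Icc_subset_Ico_of_lt hτ.2
  set κ := 2 * (C * (1 / 2 * C ^ 2 + C) + C) * τ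
  have hκ : 0 ≤ κ := by
    have hC₀ := hC.nonneg
    have hτ₀ := hτ.1.le
    positivity
  have hη : 0 < ε / (κ + 1) := by positivity
  have hu := hC.velocity_lip.eventually_abs_le isCompact_Icc
    (fun t ht => h.velocity_infty t (hsub ht)) hη
  have hφ := hC.potential_lip.eventually_abs_le isCompact_Icc
    (fun t ht => (h.potential t (hsub ht)).decay) hη
  have hneg : Tendsto (fun R : ℝ => -R) atTop (cocompact ℝ) :=
    tendsto_neg_atTop_atBot.mono_right atBot_le_cocompact
  filter_upwards [atTop_le_cocompact hu, atTop_le_cocompact hφ, hneg.eventually hu,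
    hneg.eventually hφ, eventually_ge_atTop 0] with R hu_right hφ_right hu_left hφ_left hR
  have hRR : -R ≤ R := by linarith
  have hgrowth := h.integral_energyDensity_le_add hτ.1 hτ.2 hC hRR
    (fun t ht => ⟨hu_left t ht, hu_right t ht⟩) fun t ht => ⟨hφ_left t ht, hφ_right t ht⟩
  have hinitial : ∫ x in (-R)..R, energyDensity (ρ 0) (u 0) (φ 0) x ≤ energy ρ₀ u₀ φ₀ := by
    obtain ⟨hρ_eq, hu_eq, hφ_eq⟩ := h.initial_eq hφ₀
    rw [hρ_eq, hu_eq, hφ_eq, intervalIntegral.integral_of_le hRR]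
    exact setIntegral_le_integral hH₀
      (Eventually.of_forall fun x => energyDensity_nonneg (hρ₀ x))
  have hsmall : 2 * (ε / (κ + 1)) * (C * (1 / 2 * C ^ 2 + C) + C) * τ ≤ ε :=
    calc 2 * (ε / (κ + 1)) * (C * (1 / 2 * C ^ 2 + C) + C) * τ
        = κ / (κ + 1) * ε := by simp only [κ]; ring
      _ ≤ ε := mul_le_of_le_one_left hε.le ((div_le_one (by positivity)).2 (by linarith))
  linarith

theorem abs_Vplus_potential_le (h : IsClassicalSolution T ρ₀ u₀ ρ u φ) (hρ₀ : ∀ x, 0 ≤ ρ₀ x)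
    (hφ₀ : IsPotential ρ₀ φ₀) (hH₀ : Integrable (energyDensity ρ₀ u₀ φ₀)) {t : ℝ}
    (ht : t ∈ Ioo 0 T) (x : ℝ) : |Vplus (φ t x)| ≤ energy ρ₀ u₀ φ₀ := by
  have ht' := Ioo_subset_Ico_self ht
  refine (h.potential t ht').abs_Vplus_le (fun ε hε => ?_) x
  filter_upwards [h.eventually_integral_energyDensity_le hρ₀ hφ₀ hH₀ ht hε,
    eventually_ge_atTop 0] with R hR hR₀
  refine (intervalIntegral.integral_mono_on (by linarith)
    ((h.potential t ht').continuous_fieldEnergyDensity.intervalIntegrable _ _)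
    ((h.continuous_energyDensity ht').intervalIntegrable _ _) fun y _ => ?_).trans hR
  exact fieldEnergyDensity_le_energyDensity (h.density_nonneg hρ₀ ht' y)

theorem exp_potential_mem_Icc (h : IsClassicalSolution T ρ₀ u₀ ρ u φ) (hρ₀ : ∀ x, 0 ≤ ρ₀ x)
    (hφ₀ : IsPotential ρ₀ φ₀) (hH₀ : Integrable (energyDensity ρ₀ u₀ φ₀)) {t : ℝ}
    (ht : t ∈ Ioo 0 T) (x : ℝ) :
    Real.exp (φ t x) ∈ Icc (cminus (energy ρ₀ u₀ φ₀)) (cplus (energy ρ₀ u₀ φ₀)) := by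
  have hV := abs_le.1 (h.abs_Vplus_potential_le hρ₀ hφ₀ hH₀ ht x)
  exact ⟨cminus_le_exp (energy_nonneg hρ₀) hV.1, exp_le_cplus (energy_nonneg hρ₀) hV.2⟩

end IsClassicalSolution

end

/-! ### Comparison with the harmonic oscillator -/

theorem le_oscillator {q q' q'' : ℝ → ℝ} {ω a b : ℝ} (hω : 0 < ω) (hab : a ≤ b)
    (hlen : ω * (b - a) ≤ Real.pi)
    (hqc : ContinuousOn q (Icc a b)) (hqc' : ContinuousOn q' (Icc a b))
    (hq : ∀ t ∈ Ioo a b, HasDerivAt q (q' t) t) (hq' : ∀ t ∈ Ioo a b, HasDerivAt q' (q'' t) t)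
    (hle : ∀ t ∈ Ioo a b, q'' t + ω ^ 2 * q t ≤ 0) :
    q b ≤ q a * Real.cos (ω * (b - a)) + q' a * Real.sin (ω * (b - a)) / ω := by
  -- `G t` is the value at time `b` of the oscillator with the position and velocity of `q` at `t`.
  set G : ℝ → ℝ := fun t => q t * Real.cos (ω * (b - t)) + q' t * Real.sin (ω * (b - t)) / ω
  have hG : AntitoneOn G (Icc a b) := by
    refine antitoneOn_of_hasDerivWithinAt_nonpos (convex_Icc a b)
      (f' := fun t => Real.sin (ω * (b - t)) / ω * (q'' t + ω ^ 2 * q t)) (by fun_prop) ?_ ?_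
    all_goals
      intro t ht
      rw [interior_Icc] at ht
    · have hl : HasDerivAt (fun s => ω * (b - s)) (-ω) t := by
        simpa using ((hasDerivAt_id t).const_sub b).const_mul ω
      have := ((hq t ht).mul hl.cos).add (((hq' t ht).mul hl.sin).div_const ω)
      refine (this.congr_deriv ?_).hasDerivWithinAt
      field_simp
      ring
    · have hphase : ω * (b - t) ≤ Real.pi :=
        (mul_le_mul_of_nonneg_left (by linarith [ht.1]) hω.le).trans hlen
      exact mul_nonpos_of_nonneg_of_nonpos (div_nonneg (Real.sin_nonneg_of_nonneg_of_le_pi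
        (mul_nonneg hω.le (by linarith [ht.2])) hphase) hω.le) (hle t ht)
  simpa [G] using hG (left_mem_Icc.2 hab) (right_mem_Icc.2 hab) hab

theorem exists_mul_cos_add_mul_sin_eq (q : ℝ) {p : ℝ} (hp : p ≤ 0) :
    ∃ θ ∈ Icc 0 Real.pi, q * Real.cos θ + p * Real.sin θ = -√(q ^ 2 + p ^ 2) := by
  set w : ℂ := ⟨-q, -p⟩
  have hcos : ‖w‖ * Real.cos w.arg = -q := Complex.norm_mul_cos_arg w
  have hsin : ‖w‖ * Real.sin w.arg = -p := Complex.norm_mul_sin_arg w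
  have hw : ‖w‖ = √(q ^ 2 + p ^ 2) := by simp [Complex.norm_eq_sqrt_sq_add_sq, w]
  refine ⟨w.arg, ⟨Complex.arg_nonneg_iff.2 (neg_nonneg.2 hp), Complex.arg_le_pi w⟩, ?_⟩
  rw [← hw]
  linear_combination Real.cos w.arg * hcos + Real.sin w.arg * hsin
    - ‖w‖ * Real.sin_sq_add_cos_sq w.arg

theorem exists_first_zero {f : ℝ → ℝ} {a b : ℝ} (hab : a ≤ b) (hf : ContinuousOn f (Icc a b))
    (ha : 0 ≤ f a) (hb : f b ≤ 0) :
    ∃ c ∈ Icc a b, f c = 0 ∧ ∀ s ∈ Icc a c, 0 ≤ f s := by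
  have hzeros : IsCompact (Icc a b ∩ f ⁻¹' {0}) := isCompact_Icc.of_isClosed_subset
    (hf.preimage_isClosed_of_isClosed isClosed_Icc isClosed_singleton) inter_subset_left
  obtain ⟨c₀, hc₀, hfc₀⟩ := intermediate_value_Icc' hab hf ⟨hb, ha⟩
  obtain ⟨c, ⟨hc, hfc⟩, hleast⟩ := hzeros.exists_isLeast ⟨c₀, hc₀, hfc₀⟩
  refine ⟨c, hc, hfc, fun s hs => ?_⟩
  by_contra! hneg
  have hsb : Icc a s ⊆ Icc a b := Icc_subset_Icc_right (hs.2.trans hc.2)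
  obtain ⟨c', hc', hfc'⟩ := intermediate_value_Icc' hs.1 (hf.mono hsb) ⟨hneg.le, ha⟩
  have hsc : s = c := le_antisymm hs.2 ((hleast ⟨hsb hc', hfc'⟩).trans hc'.2)
  exact hneg.ne (hsc ▸ hfc)

/-- `y` is a positive solution on `[0, T)` of `y'' + k y = r`, with `y' = z` and
`cm ≤ k ≤ cp`. -/
structure IsPosSolution (T r cm cp : ℝ) (k y z : ℝ → ℝ) : Prop where
  cont_y : ContinuousOn y (Ico 0 T)
  cont_z : ContinuousOn z (Ico 0 T)
  deriv_y : ∀ t ∈ Ioo 0 T, HasDerivAt y (z t) t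
  deriv_z : ∀ t ∈ Ioo 0 T, HasDerivAt z (r - k t * y t) t
  lower : ∀ t ∈ Ioo 0 T, cm ≤ k t
  upper : ∀ t ∈ Ioo 0 T, k t ≤ cp
  pos : ∀ t ∈ Ico 0 T, 0 < y t

/-- The time at which a solution of `y'' + k y = r`, `y 0 = 1`, whose data violate the threshold
has vanished: `√r / cm` to reach the equilibrium `r / cm`, half a period of the oscillator of
frequency `√cm` to turn around, and another half period to come down to zero. -/
def lifespanBound (r cm : ℝ) : ℝ := √r / cm + Real.pi / √cm + Real.pi / √cm

theorem lifespanBound_pos (r : ℝ) {cm : ℝ} (hcm : 0 < cm) : 0 < lifespanBound r cm := by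
  unfold lifespanBound
  positivity

/-- The left-hand side is the excess of the upper radicand over `2 r - cp`, the right-hand side the
energy `z² + cp y² - 2 r y` at the turning point `z = 0`, `y = 2 r / cm`. -/
theorem radicand_eq_energy {r cm cp : ℝ} (hcm : 0 < cm) : 4 / cm * (cp / cm - 1) * r ^ 2
    = cp * (2 * r / cm) ^ 2 - 2 * r * (2 * r / cm) := by
  field_simp
  ring

namespace IsPosSolution

variable {T r cm cp a b t : ℝ} {k y z : ℝ → ℝ}

theorem lower_le_upper (h : IsPosSolution T r cm cp k y z) (hT : 0 < T) : cm ≤ cp :=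
  have hmid : T / 2 ∈ Ioo 0 T := ⟨half_pos hT, half_lt_self hT⟩
  (h.lower _ hmid).trans (h.upper _ hmid)

theorem le_oscillator (h : IsPosSolution T r cm cp k y z) (hcm : 0 < cm) (ha : 0 ≤ a)
    (hab : a ≤ b) (hb : b < T) (hlen : √cm * (b - a) ≤ Real.pi) :
    y b - r / cm ≤ (y a - r / cm) * Real.cos (√cm * (b - a))
      + z a * Real.sin (√cm * (b - a)) / √cm := by
  have hsub : Icc a b ⊆ Ico 0 T := fun t ht => ⟨ha.trans ht.1, ht.2.trans_lt hb⟩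
  have hsub' : Ioo a b ⊆ Ioo 0 T := Ioo_subset_Ioo ha hb.le
  refine ColdIon.le_oscillator (q := fun t => y t - r / cm) (q' := z)
    (q'' := fun t => r - k t * y t) (Real.sqrt_pos.2 hcm) hab hlen
    ((h.cont_y.mono hsub).sub continuousOn_const) (h.cont_z.mono hsub)
    (fun t ht => (h.deriv_y t (hsub' ht)).sub_const _) (fun t ht => h.deriv_z t (hsub' ht))
    fun t ht => ?_
  have hky : cm * y t ≤ k t * y t := mul_le_mul_of_nonneg_right (h.lower t (hsub' ht))
    (h.pos t (hsub (Ioo_subset_Icc_self ht))).le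
  rw [Real.sq_sqrt hcm.le, mul_sub, mul_div_cancel₀ _ hcm.ne']
  linarith

theorem lifespan_le_of_nonpos (h : IsPosSolution T r cm cp k y z) (hcm : 0 < cm)
    (ha : a ∈ Ico 0 T) (hz : z a ≤ 0) (hen : 2 * r * y a - cm * y a ^ 2 ≤ z a ^ 2) :
    T ≤ a + Real.pi / √cm := by
  by_contra! hT
  have hω : 0 < √cm := Real.sqrt_pos.2 hcm
  obtain ⟨θ, ⟨hθ0, hθπ⟩, hθ⟩ := exists_mul_cos_add_mul_sin_eq (y a - r / cm)
    (div_nonpos_of_nonpos_of_nonneg hz hω.le)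
  have hamplitude : r / cm ≤ √((y a - r / cm) ^ 2 + (z a / √cm) ^ 2) := by
    refine Real.le_sqrt_of_sq_le (sub_nonneg.1 ?_)
    have hexcess : (y a - r / cm) ^ 2 + (z a / √cm) ^ 2 - (r / cm) ^ 2
        = (z a ^ 2 - (2 * r * y a - cm * y a ^ 2)) / cm := by
      rw [div_pow (z a), Real.sq_sqrt hcm.le]
      field_simp
      ring
    rw [hexcess]
    exact div_nonneg (sub_nonneg.2 hen) hcm.le
  have hab : a ≤ a + θ / √cm := le_add_of_nonneg_right (div_nonneg hθ0 hω.le)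
  have hbT : a + θ / √cm < T := lt_of_le_of_lt (by gcongr) hT
  have hphase : √cm * (a + θ / √cm - a) = θ := by
    rw [add_sub_cancel_left, mul_div_cancel₀ _ hω.ne']
  have hosc := h.le_oscillator hcm ha.1 hab hbT (hphase.trans_le hθπ)
  rw [hphase, mul_div_right_comm, hθ] at hosc
  linarith [h.pos _ ⟨ha.1.trans hab, hbT⟩]

theorem monotoneOn (h : IsPosSolution T r cm cp k y z) (hb : b < T)
    (hz : ∀ t ∈ Icc 0 b, 0 ≤ z t) : MonotoneOn y (Icc 0 b) := by
  refine monotoneOn_of_hasDerivWithinAt_nonneg (convex_Icc 0 b) (f' := z)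
    (h.cont_y.mono (Icc_subset_Ico_of_lt hb)) (fun t ht => ?_)
    fun t ht => hz t (interior_subset ht)
  rw [interior_Icc] at ht ⊢
  exact (h.deriv_y t ⟨ht.1, ht.2.trans hb⟩).hasDerivWithinAt

theorem monotoneOn_energy (h : IsPosSolution T r cm cp k y z) (hb : b < T)
    (hz : ∀ t ∈ Icc 0 b, 0 ≤ z t) :
    MonotoneOn (fun t => z t ^ 2 + cp * y t ^ 2 - 2 * r * y t) (Icc 0 b) := by
  have hsub := Icc_subset_Ico_of_lt hb
  have hcy := h.cont_y.mono hsub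
  have hcz := h.cont_z.mono hsub
  refine monotoneOn_of_hasDerivWithinAt_nonneg (convex_Icc 0 b)
    (f' := fun t => 2 * z t * ((cp - k t) * y t)) (by fun_prop) ?_ ?_
  all_goals
    intro t ht
    rw [interior_Icc] at ht
    have htT : t ∈ Ioo 0 T := ⟨ht.1, ht.2.trans hb⟩
  · have := (((h.deriv_z t htT).fun_pow 2).add (((h.deriv_y t htT).fun_pow 2).const_mul cp)).sub
      ((h.deriv_y t htT).const_mul (2 * r))
    refine (this.congr_deriv ?_).hasDerivWithinAt
    push_cast
    ring
  · have hzt := hz t (Ioo_subset_Icc_self ht)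
    have hyt := h.pos t (Ioo_subset_Ico_self htT)
    have hk := sub_nonneg.2 (h.upper t htT)
    positivity

theorem sqrt_le_velocity (h : IsPosSolution T r cm cp k y z) (hcm : 0 < cm) (hr : 0 ≤ r)
    (hy0 : y 0 = 1) (hen : 2 * r - cp + 4 / cm * (cp / cm - 1) * r ^ 2 ≤ z 0 ^ 2) (hb : b < T)
    (hz : ∀ t ∈ Icc 0 b, 0 ≤ z t) (ht : t ∈ Icc 0 b) (hyt : y t ≤ r / cm) : √r ≤ z t := by
  have h0 : 0 ∈ Icc 0 b := left_mem_Icc.2 (ht.1.trans ht.2)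
  have hcmp := h.lower_le_upper (h0.2.trans_lt hb)
  have hy1 : 1 ≤ y t := hy0.symm.trans_le (h.monotoneOn hb hz h0 ht ht.1)
  have hE := h.monotoneOn_energy hb hz h0 ht ht.1
  simp only [hy0] at hE
  rw [radicand_eq_energy hcm] at hen
  have hr_eq : r = cm * (r / cm) := (mul_div_cancel₀ _ hcm.ne').symm
  set e := r / cm
  have he : 2 * r / cm = 2 * e := mul_div_assoc _ _ _
  rw [he] at hen
  have hconvex : cp * y t ^ 2 ≤ cp * e * y t := by
    rw [sq, ← mul_assoc]
    have hcp : 0 ≤ cp := hcm.le.trans hcmp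
    gcongr
  have hforce : (cp - cm) * e * y t ≤ (cp - cm) * e * e := by
    have : 0 ≤ e := by positivity
    have : 0 ≤ cp - cm := sub_nonneg.2 hcmp
    gcongr
  have hpos : 0 ≤ (cp - cm) * e * e := by
    rw [mul_assoc]
    exact mul_nonneg (sub_nonneg.2 hcmp) (mul_self_nonneg e)
  refine Real.sqrt_le_iff.2 ⟨hz t ht, ?_⟩
  have hry : r ≤ r * y t := le_mul_of_one_le_right hr hy1
  rw [hr_eq] at hen hE hry ⊢
  linarith

theorem equilibrium_le (h : IsPosSolution T r cm cp k y z) (hcm : 0 < cm) (hr : 0 ≤ r)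
    (hy0 : y 0 = 1) (hen : 2 * r - cp + 4 / cm * (cp / cm - 1) * r ^ 2 ≤ z 0 ^ 2)
    (hT : √r / cm < T) (hz : ∀ t ∈ Icc 0 (√r / cm), 0 ≤ z t) : r / cm ≤ y (√r / cm) := by
  by_contra! hlt
  have ht₀ : 0 ≤ √r / cm := by positivity
  have hvel : ∀ t ∈ Icc 0 (√r / cm), √r ≤ z t := fun t ht =>
    h.sqrt_le_velocity hcm hr hy0 hen hT hz ht
      ((h.monotoneOn hT hz ht (right_mem_Icc.2 ht₀) ht.2).trans hlt.le)
  have hgrow : MonotoneOn (fun t => y t - √r * t) (Icc 0 (√r / cm)) := by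
    refine monotoneOn_of_hasDerivWithinAt_nonneg (convex_Icc _ _) (f' := fun t => z t - √r)
      ((h.cont_y.mono (Icc_subset_Ico_of_lt hT)).sub (by fun_prop)) (fun t ht => ?_)
      fun t ht => sub_nonneg.2 (hvel t (interior_subset ht))
    rw [interior_Icc] at ht ⊢
    have := (h.deriv_y t ⟨ht.1, ht.2.trans hT⟩).sub ((hasDerivAt_id t).const_mul (√r))
    exact (this.congr_deriv (by rw [mul_one])).hasDerivWithinAt
  have hgain := hgrow (left_mem_Icc.2 ht₀) (right_mem_Icc.2 ht₀) ht₀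
  simp only [hy0, mul_zero, sub_zero, ← mul_div_assoc, Real.mul_self_sqrt hr] at hgain
  linarith

theorem exists_nonpos (h : IsPosSolution T r cm cp k y z) (hcm : 0 < cm) (hr : 0 ≤ r)
    (hy0 : y 0 = 1) (hen : 2 * r - cp + 4 / cm * (cp / cm - 1) * r ^ 2 ≤ z 0 ^ 2)
    (hT : √r / cm + Real.pi / √cm < T) :
    ∃ t ∈ Icc 0 (√r / cm + Real.pi / √cm), z t ≤ 0 := by
  by_contra! hz
  have hω : 0 < √cm := Real.sqrt_pos.2 hcm
  set t₀ := √r / cm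
  set t₁ := t₀ + Real.pi / √cm
  have ht₀ : 0 ≤ t₀ := by positivity
  have ht₀₁ : t₀ < t₁ := lt_add_of_pos_right _ (div_pos Real.pi_pos hω)
  have hequil : r / cm ≤ y t₀ := h.equilibrium_le hcm hr hy0 hen (ht₀₁.trans hT)
    fun t ht => (hz t ⟨ht.1, ht.2.trans ht₀₁.le⟩).le
  have hphase : √cm * (t₁ - t₀) = Real.pi := by
    rw [add_sub_cancel_left, mul_div_cancel₀ _ hω.ne']
  have hosc := h.le_oscillator hcm ht₀ ht₀₁.le hT hphase.le
  rw [hphase, Real.cos_pi, Real.sin_pi, mul_zero, zero_div] at hosc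
  have hincr : StrictMonoOn y (Icc t₀ t₁) := by
    refine strictMonoOn_of_hasDerivWithinAt_pos (convex_Icc t₀ t₁) (f' := z)
      (h.cont_y.mono fun t ht => ⟨ht₀.trans ht.1, ht.2.trans_lt hT⟩) ?_ ?_
    all_goals
      intro t ht
      rw [interior_Icc] at ht
    · exact (h.deriv_y t ⟨ht₀.trans_lt ht.1, ht.2.trans hT⟩).hasDerivWithinAt
    · exact hz t ⟨ht₀.trans ht.1.le, ht.2.le⟩
  linarith [hincr (left_mem_Icc.2 ht₀₁.le) (right_mem_Icc.2 ht₀₁.le) ht₀₁]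

theorem le_turning_point (h : IsPosSolution T r cm cp k y z) (hcm : 0 < cm)
    (hy0 : y 0 = 1) (hen : 2 * r - cp + 4 / cm * (cp / cm - 1) * r ^ 2 ≤ z 0 ^ 2)
    (ha : a ∈ Ico 0 T) (hza : z a = 0) (hz : ∀ t ∈ Icc 0 a, 0 ≤ z t) : 2 * r / cm ≤ y a := by
  have hE := h.monotoneOn_energy ha.2 hz (left_mem_Icc.2 ha.1) (right_mem_Icc.2 ha.1) ha.1
  simp only [hy0, hza] at hE
  rw [radicand_eq_energy hcm] at hen
  have hcmp := h.lower_le_upper (ha.1.trans_lt ha.2)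
  have hya := h.pos a ha
  set Y := 2 * r / cm
  have hY : 2 * r = cm * Y := (mul_div_cancel₀ _ hcm.ne').symm
  have hfactor : 0 ≤ (y a - Y) * (cp * y a + (cp - cm) * Y) := by
    rw [hY] at hE hen
    linarith
  by_contra! hlt
  have hpos : 0 < cp * y a + (cp - cm) * Y :=
    add_pos_of_pos_of_nonneg (mul_pos (hcm.trans_le hcmp) hya)
      (mul_nonneg (sub_nonneg.2 hcmp) (hya.trans hlt).le)
  linarith [mul_neg_of_neg_of_pos (sub_neg.2 hlt) hpos]

theorem lifespan_le_of_le_neg_sqrt (h : IsPosSolution T r cm cp k y z) (hT : 0 < T)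
    (hcm : 0 < cm) (hy0 : y 0 = 1) (hv : z 0 ≤ -√(2 * r - cm)) : T ≤ Real.pi / √cm := by
  have hen : 2 * r - cm ≤ z 0 ^ 2 := by
    rw [← neg_sq]
    exact Real.sqrt_le_iff.1 (le_neg_of_le_neg hv) |>.2
  have := h.lifespan_le_of_nonpos hcm ⟨le_rfl, hT⟩
    (hv.trans (neg_nonpos.2 (Real.sqrt_nonneg _))) (by simpa [hy0] using hen)
  rwa [zero_add] at this

theorem lifespan_le_of_sqrt_le (h : IsPosSolution T r cm cp k y z) (hcm : 0 < cm) (hr : 0 ≤ r)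
    (hy0 : y 0 = 1) (hv : √(2 * r - cp + 4 / cm * (cp / cm - 1) * r ^ 2) ≤ z 0) :
    T ≤ lifespanBound r cm := by
  by_contra! hT
  obtain ⟨hz0, hen⟩ := Real.sqrt_le_iff.1 hv
  have hT' : √r / cm + Real.pi / √cm < T :=
    (le_add_of_nonneg_right (by positivity)).trans_lt hT
  obtain ⟨t, ht, hzt⟩ := h.exists_nonpos hcm hr hy0 hen hT'
  obtain ⟨a, ha, hza, hz⟩ := exists_first_zero ht.1
    (h.cont_z.mono (Icc_subset_Ico_of_lt (ht.2.trans_lt hT'))) hz0 hzt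
  have haT : a ∈ Ico 0 T := ⟨ha.1, (ha.2.trans ht.2).trans_lt hT'⟩
  have hturn := h.le_turning_point hcm hy0 hen haT hza hz
  have hlifespan := h.lifespan_le_of_nonpos hcm haT hza.le (by
    rw [div_le_iff₀ hcm] at hturn
    rw [hza]
    nlinarith [h.pos a haT])
  unfold lifespanBound at hT
  linarith [ha.2, ht.2]

theorem lifespan_le (h : IsPosSolution T r cm cp k y z) (hcm : 0 < cm) (hr : 0 ≤ r)
    (hy0 : y 0 = 1) (hviol : ¬ Threshold cm cp r (z 0)) : T ≤ lifespanBound r cm := by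
  rcases not_and_or.1 hviol with hlow | hhigh
  · rcases le_or_gt T 0 with hT | hT
    · exact hT.trans (lifespanBound_pos r hcm).le
    · refine (h.lifespan_le_of_le_neg_sqrt hT hcm hy0 (not_lt.1 hlow)).trans
        (le_add_of_nonneg_left ?_)
      positivity
  · exact h.lifespan_le_of_sqrt_le hcm hr hy0 (not_lt.1 hhigh)

end IsPosSolution

/-! ### The second-order equation along a characteristic -/

theorem IsPotential.abs_field_sub_le {ρ φ : ℝ → ℝ} (h : IsPotential ρ φ) {B M : ℝ}
    (hφ : ∀ x, φ x ≤ B) (hρ : ∀ x, |ρ x| ≤ M) (x y : ℝ) :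
    |deriv φ x - deriv φ y| ≤ (Real.exp B + M) * |x - y| := by
  refine convex_univ.norm_image_sub_le_of_norm_hasDerivWithin_le
    (fun z _ => (h.hasDerivAt_deriv z).hasDerivWithinAt) (fun z _ => ?_) (mem_univ _) (mem_univ _)
  refine (abs_sub _ _).trans (add_le_add ?_ (hρ z))
  rw [Real.abs_exp]
  exact Real.exp_le_exp.2 (hφ z)

namespace IsClassicalSolution

variable {T τ C t : ℝ} {ρ₀ u₀ φ₀ X : ℝ → ℝ} {ρ u φ Y : ℝ → ℝ → ℝ}

theorem continuousOn_field_along (h : IsClassicalSolution T ρ₀ u₀ ρ u φ) (hτ : τ < T)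
    (hX : ContinuousOn X (Icc 0 τ)) : ContinuousOn (fun t => deriv (φ t) (X t)) (Icc 0 τ) := by
  obtain ⟨C, hC⟩ := h.exists_uniformBounds hτ
  exact hC.field_lip.continuousOn_along
    (fun t ht => (h.potential t (Icc_subset_Ico_of_lt hτ ht)).continuous_deriv) hX

theorem continuousOn_deriv_field_along (h : IsClassicalSolution T ρ₀ u₀ ρ u φ) (hτ : τ < T)
    (hX : ContinuousOn X (Icc 0 τ)) :
    ContinuousOn (fun t => Real.exp (φ t (X t)) - ρ t (X t)) (Icc 0 τ) := by
  obtain ⟨C, hC⟩ := h.exists_uniformBounds hτ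
  have hsub := Icc_subset_Ico_of_lt hτ
  exact (hC.potential_lip.continuousOn_along
    (fun t ht => (h.potential t (hsub ht)).continuous) hX).rexp.sub
    (h.density_C1.continuousOn_along hsub hX)

theorem velocity_along (h : IsClassicalSolution T ρ₀ u₀ ρ u φ) (hτ : τ < T)
    (hX : IsIntegralCurveOn X u (Icc 0 τ)) (ht : t ∈ Icc 0 τ) :
    u t (X t) = u 0 (X 0) - ∫ s in (0 : ℝ)..t, deriv (φ s) (X s) := by
  have hsub : Icc 0 t ⊆ Icc 0 τ := Icc_subset_Icc_right ht.2
  have hderiv : ∀ s ∈ Ioo 0 t, HasDerivAt (fun s => u s (X s)) (-deriv (φ s) (X s)) s := by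
    intro s hs
    have hsT : s ∈ Ioo 0 T := ⟨hs.1, (hs.2.trans_le ht.2).trans hτ⟩
    rw [← h.momentum s hsT (X s)]
    exact h.velocity_C1.hasDerivAt_along hsT
      (hasDerivAt_of_isIntegralCurveOn hX ⟨hs.1, hs.2.trans_le ht.2⟩)
  have hint := (h.continuousOn_field_along hτ hX.continuousOn).mono (uIcc_of_le ht.1 ▸ hsub)
  have hFTC := intervalIntegral.integral_eq_sub_of_hasDerivAt_of_le ht.1
    ((h.velocity_C1.continuousOn_along (Icc_subset_Ico_of_lt hτ) hX.continuousOn).mono hsub)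
    hderiv hint.neg.intervalIntegrable
  rw [intervalIntegral.integral_neg] at hFTC
  linarith

theorem hasDerivAt_field_flow (h : IsClassicalSolution T ρ₀ u₀ ρ u φ) (hτ : τ < T)
    (hY : IsFlow τ u Y) (ht : t ∈ Icc 0 τ) (x₀ : ℝ) :
    HasDerivAt (fun x => deriv (φ t) (Y x t))
      ((Real.exp (φ t (Y x₀ t)) - ρ t (Y x₀ t)) * stretch u (Y x₀) t) x₀ :=
  HasDerivAt.comp (h₂ := deriv (φ t)) x₀
    ((h.potential t (Icc_subset_Ico_of_lt hτ ht)).hasDerivAt_deriv (Y x₀ t))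
    (hY.hasDerivAt h.velocity_C1 hτ ht x₀)

theorem abs_field_flow_sub_le (h : IsClassicalSolution T ρ₀ u₀ ρ u φ) (hτ : τ < T)
    (hC : UniformBounds τ C ρ u φ) (hY : IsFlow τ u Y) (ht : t ∈ Icc 0 τ) (x x' : ℝ) :
    |deriv (φ t) (Y x t) - deriv (φ t) (Y x' t)|
      ≤ (Real.exp C + C) * Real.exp (C * t) * |x - x'| := by
  have hC₀ := hC.nonneg
  calc |deriv (φ t) (Y x t) - deriv (φ t) (Y x' t)|
      ≤ (Real.exp C + C) * |Y x t - Y x' t| :=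
        (h.potential t (Icc_subset_Ico_of_lt hτ ht)).abs_field_sub_le
          (fun x => (le_abs_self _).trans (hC.potential t ht x)) (hC.density t ht) _ _
    _ ≤ (Real.exp C + C) * (Real.exp (C * t) * |x - x'|) := by
        gcongr
        exact hY.abs_sub_le h.velocity_C1 hτ hC₀ hC.velocity_deriv ht x x'
    _ = (Real.exp C + C) * Real.exp (C * t) * |x - x'| := (mul_assoc _ _ _).symm

theorem hasDerivAt_integral_field_flow (h : IsClassicalSolution T ρ₀ u₀ ρ u φ) (hτ : τ < T)
    (hY : IsFlow τ u Y) (ht : t ∈ Icc 0 τ) (x₀ : ℝ) :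
    HasDerivAt (fun x => ∫ s in (0 : ℝ)..t, deriv (φ s) (Y x s))
      (∫ s in (0 : ℝ)..t, (Real.exp (φ s (Y x₀ s)) - ρ s (Y x₀ s)) * stretch u (Y x₀) s) x₀ := by
  obtain ⟨C, hC⟩ := h.exists_uniformBounds hτ
  have hIcc : uIcc 0 t ⊆ Icc 0 τ := by
    rw [uIcc_of_le ht.1]
    exact Icc_subset_Icc_right ht.2
  have hmem : uIoc 0 t ⊆ Icc 0 τ := uIoc_subset_uIcc.trans hIcc
  have hmeas : ∀ {f : ℝ → ℝ}, ContinuousOn f (Icc 0 τ) →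
      AEStronglyMeasurable f (volume.restrict (uIoc 0 t)) := fun hf =>
    (hf.mono hmem).aestronglyMeasurable measurableSet_uIoc
  have hfield := fun x => h.continuousOn_field_along hτ (hY x).1.continuousOn
  refine (intervalIntegral.hasDerivAt_integral_of_dominated_loc_of_lip
    (bound := fun s => (Real.exp C + C) * Real.exp (C * s)) univ_mem
    (Eventually.of_forall fun x => hmeas (hfield x)) ((hfield x₀).mono hIcc).intervalIntegrable
    (hmeas ((h.continuousOn_deriv_field_along hτ (hY x₀).1.continuousOn).mul
      (continuousOn_stretch h.velocity_C1 (ht.1.trans ht.2) hτ (hY x₀).1.continuousOn)))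
    (Eventually.of_forall fun s hs => ?_)
    (Continuous.intervalIntegrable (by fun_prop) _ _)
    (Eventually.of_forall fun s hs => h.hasDerivAt_field_flow hτ hY (hmem hs) x₀)).2
  refine LipschitzOnWith.of_dist_le_mul fun x _ x' _ => ?_
  rw [Real.coe_nnabs]
  exact (h.abs_field_flow_sub_le hτ hC hY (hmem hs) x x').trans
    (mul_le_mul_of_nonneg_right (le_abs_self _) (abs_nonneg _))

theorem deriv_velocity_mul_stretch (h : IsClassicalSolution T ρ₀ u₀ ρ u φ) (hτ : τ < T)
    (hY : IsFlow τ u Y) (ht : t ∈ Icc 0 τ) (x : ℝ) :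
    deriv (u t) (Y x t) * stretch u (Y x) t = deriv (u 0) x
      - ∫ s in (0 : ℝ)..t, (Real.exp (φ s (Y x s)) - ρ s (Y x s)) * stretch u (Y x) s := by
  have hleft : HasDerivAt (fun x => u t (Y x t)) (deriv (u t) (Y x t) * stretch u (Y x) t) x :=
    HasDerivAt.comp x (h.velocity_C1.hasDerivAt_space (Icc_subset_Ico_of_lt hτ ht) (Y x t))
      (hY.hasDerivAt h.velocity_C1 hτ ht x)
  have hright := (h.velocity_C1.hasDerivAt_space ⟨le_rfl, h.pos⟩ x).fun_sub
    (h.hasDerivAt_integral_field_flow hτ hY ht x)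
  refine hleft.unique (hright.congr_of_eventuallyEq (Eventually.of_forall fun x' => ?_))
  simpa only [(hY x').2] using h.velocity_along hτ (hY x').1 ht

theorem hasDerivAt_deriv_velocity_mul_stretch (h : IsClassicalSolution T ρ₀ u₀ ρ u φ)
    (hτ : τ < T) (hY : IsFlow τ u Y) (ht : t ∈ Ioo 0 τ) (x : ℝ) :
    HasDerivAt (fun t => deriv (u t) (Y x t) * stretch u (Y x) t)
      (ρ₀ x - Real.exp (φ t (Y x t)) * stretch u (Y x) t) t := by
  have hcont := (h.continuousOn_deriv_field_along hτ (hY x).1.continuousOn).mul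
    (continuousOn_stretch h.velocity_C1 (ht.1.trans ht.2).le hτ (hY x).1.continuousOn)
  have hmass := h.density_mul_stretch hτ (hY x).1 (Ioo_subset_Icc_self ht)
  rw [(hY x).2] at hmass
  refine (((hasDerivAt_primitive hcont ht).const_sub (deriv (u 0) x)).congr_of_eventuallyEq
    ?_).congr_deriv (by rw [← hmass, Pi.mul_apply]; ring)
  filter_upwards [Icc_mem_nhds ht.1 ht.2] with s hs
  exact h.deriv_velocity_mul_stretch hτ hY hs x

theorem isPosSolution_stretch (h : IsClassicalSolution T ρ₀ u₀ ρ u φ) (hρ₀ : ∀ x, 0 ≤ ρ₀ x)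
    (hφ₀ : IsPotential ρ₀ φ₀) (hH₀ : Integrable (energyDensity ρ₀ u₀ φ₀)) (hτ₀ : 0 ≤ τ)
    (hτ : τ < T) (hY : IsFlow τ u Y) (x : ℝ) :
    IsPosSolution τ (ρ₀ x) (cminus (energy ρ₀ u₀ φ₀)) (cplus (energy ρ₀ u₀ φ₀))
      (fun t => Real.exp (φ t (Y x t))) (stretch u (Y x))
      (fun t => deriv (u t) (Y x t) * stretch u (Y x) t) where
  cont_y := (continuousOn_stretch h.velocity_C1 hτ₀ hτ (hY x).1.continuousOn).mono
    Ico_subset_Icc_self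
  cont_z := ((h.velocity_C1.continuousOn_deriv_along (Icc_subset_Ico_of_lt hτ)
    (hY x).1.continuousOn).mul
    (continuousOn_stretch h.velocity_C1 hτ₀ hτ (hY x).1.continuousOn)).mono Ico_subset_Icc_self
  deriv_y _ ht := hasDerivAt_stretch h.velocity_C1 hτ (hY x).1.continuousOn ht
  deriv_z _ ht := h.hasDerivAt_deriv_velocity_mul_stretch hτ hY ht x
  lower _ ht := (h.exp_potential_mem_Icc hρ₀ hφ₀ hH₀ ⟨ht.1, ht.2.trans hτ⟩ _).1
  upper _ ht := (h.exp_potential_mem_Icc hρ₀ hφ₀ hH₀ ⟨ht.1, ht.2.trans hτ⟩ _).2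
  pos t _ := stretch_pos u (Y x) t

theorem le_lifespanBound (h : IsClassicalSolution T ρ₀ u₀ ρ u φ) (hρ₀ : ∀ x, 0 ≤ ρ₀ x)
    (hφ₀ : IsPotential ρ₀ φ₀) (hH₀ : Integrable (energyDensity ρ₀ u₀ φ₀)) {x : ℝ}
    (hviol : ¬ Threshold (cminus (energy ρ₀ u₀ φ₀)) (cplus (energy ρ₀ u₀ φ₀)) (ρ₀ x)
      (deriv u₀ x)) :
    T ≤ lifespanBound (ρ₀ x) (cminus (energy ρ₀ u₀ φ₀)) := by
  refine le_of_forall_lt_imp_le_of_dense fun τ hτ => ?_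
  have hcm : 0 < cminus (energy ρ₀ u₀ φ₀) := Real.exp_pos _
  rcases le_or_gt τ 0 with hτ₀ | hτ₀
  · exact hτ₀.trans (lifespanBound_pos _ hcm).le
  obtain ⟨Y, hY⟩ := exists_isFlow h.velocity_C1 hτ₀.le hτ
  have hy := h.isPosSolution_stretch hρ₀ hφ₀ hH₀ hτ₀.le hτ hY x
  refine hy.lifespan_le hcm (hρ₀ x) (stretch_zero _ _) ?_
  rwa [stretch_zero, mul_one, (hY x).2, (h.initial_eq hφ₀).2.1]

end IsClassicalSolution

end ColdIon

end

theorem theorem1p8 (ρ₀ u₀ φ₀ : ℝ → ℝ)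
    (hρ₀ : ∀ x, 0 ≤ ρ₀ x)
    (hφ₀ : ColdIon.IsPotential ρ₀ φ₀)
    (hH₀ : MeasureTheory.Integrable (ColdIon.energyDensity ρ₀ u₀ φ₀))
    (hviol : ∃ x, ¬ ColdIon.Threshold
      (ColdIon.cminus (ColdIon.energy ρ₀ u₀ φ₀)) (ColdIon.cplus (ColdIon.energy ρ₀ u₀ φ₀))
      (ρ₀ x) (deriv u₀ x)) :
    ∃ Tstar : ℝ, 0 < Tstar ∧ ∀ (T : ℝ) (ρ u φ : ℝ → ℝ → ℝ),
      ColdIon.IsClassicalSolution T ρ₀ u₀ ρ u φ → T ≤ Tstar := by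
  obtain ⟨x, hx⟩ := hviol
  exact ⟨_, ColdIon.lifespanBound_pos (ρ₀ x) (Real.exp_pos _), fun _ _ _ _ h =>
    h.le_lifespanBound hρ₀ hφ₀ hH₀ hx⟩
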